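/- Let $\mathbb L^3$ be $\mathbb R^3$ with the Lorentzian product $\langle v,w\rangle=v_1w_1+v_2w_2-v_3w_3$, let $a\times b$ be the Lorentzian cross product, $\langle a\times b,c\rangle=\det(a,b,c)$, and identify $v\in\mathbb L^3$ with the Hermitian matrix $$\widetilde v=\begin{pmatrix} v_3& v_2+iv_1\\ v_2-iv_1& v_3\end{pmatrix}.$$ Let $SU(1,1)$ be the group of $A\in M(2,\mathbb C)$ with $\det A=1$ and $\overline A^{t}\,\mathrm{diag}(1,-1)\,A=\mathrm{diag}(1,-1)$, let $J=\begin{pmatrix}0&i\\ i&0\end{pmatrix}$ and $SU^-(1,1)=SU(1,1)\cdot J$. A matrix $A\in SU(1,1)$ is a pre-image of the isometry $R_A$ of $\mathbb L^3$ given by $\widetilde v\mapsto \overline A^{t}\,\widetilde v\,A$, and $A\in SU^-(1,1)$ is a pre-image of the isometry $R_A$ given by $\widetilde v\mapsto -\overline A^{t}\,\widetilde v\,A$. **Data.** Let $n\ge 0$; indices $i=1,\dots,n+3$ are taken modulo $n+3$. Let $u_1,\dots,u_{n+3}\in\mathbb L^3$ span $\mathbb R^3$ and satisfy $\langle u_i,u_i\rangle=1$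 and $\langle u_{i-1}\times u_i,\,u_{i-1}\times u_i\rangle<0$ for all $i$ (the oriented edge directions of a non-planar, non-degenerate spacelike polygonal curve). Put $$v_i=-\frac{u_{i-1}\times u_i}{\sqrt{-\langle u_{i-1}\times u_i,u_{i-1}\times u_i\rangle}},\qquad \theta_i\in(0,1),\quad \cos(\pi\theta_i)=\langle u_{i-1},u_i\rangle .$$ Let $t_1<\dots<t_{n+2}$ be real and $t_{n+3}=\infty$. The interval $(t_i,t_{i+1})$ is understood in $\mathbb R\cup\{\infty\}$, so that $(t_{n+2},t_{n+3})=(t_{n+2},+\infty)$ and $(t_{n+3},t_1)=(-\infty,t_1)$. Let $X$ be a maxface on the upper half-plane $\mathbb C_+$, that is, a differentiable map $X:\mathbb C_+\to\mathbb L^3$ such that $\Phi=\partial X/\partial x$ is holomorphic and nowhere zero, $\Phi_1^2+\Phi_2^2-\Phi_3^2=0$, and $|\Phi_1|^2+|\Phi_2|^2-|\Phi_3|^2\not\equiv0$. Assume that * $X$ extends continuously to $\mathbb C_+\cup\mathbb R$, and has a limit in $\mathbb R^3\cup\{\infty\}$ as $x\to\infty$ in $\mathbb C_+\cup\mathbb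 R$; * for every $i$, $X$ maps $(t_i,t_{i+1})$ into a straight line directed by $u_i$, and its coordinate along $u_i$ is strictly increasing on this interval (so $X$ parametrizes a possibly unclosed polygonal curve with edge directions $u_i$, whose vertices have the pre-images $t_i$); * $X$ has no boundary branch point inside the edges: $\Phi$ does not tend to $0$ at any point of the intervals $(t_i,t_{i+1})$. Let $(G,H)$ be Weierstrass data of $X$: holomorphic functions on $\mathbb C_+$ with $$X(x)=X_0+\mathrm{Re}\int_{x_0}^x\big(H^2-G^2,\ i(G^2+H^2),\ 2iGH\big)\,dx .$$ For a base point in $\mathbb C_+$ let $\gamma_i$ be a simple loop around $t_i$: it starts in $\mathbb C_+$, crosses $(t_{i-1},t_i)$ into the lower half-plane, and returns to the base point in $\mathbb C_+$ through $(t_i,t_{i+1})$. **Proposition.** The row vector $(G,H)$ can be continued analytically along each $\gamma_i$, and there is a unique matrix $M_i$, independent of the base point and of the choice of $\gamma_i$, such that the result of the continuation is $(G,H)M_i$. Moreover one can choose, for all $i$ simultaneously, a pre-image $D_i\in SU^-(1,1)$ of the hyperbolic half-turn $v\mapsto 2\langle v,u_i\rangle u_i-v$ about the direction $u_i$ such that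 $$M_i=D_iD_{i-1}^{-1}\qquad(i=1,\dots,n+3).$$ Hence each $M_i$ lies in $SU(1,1)$ and is a pre-image of the direct isometry with timelike axis $v_i$ and angle $2\pi\theta_i$, that is, of an element of $SO^+(2,1)$ that fixes $v_i$ and has the eigenvalues $1,e^{2\pi i\theta_i},e^{-2\pi i\theta_i}$. -/

import Mathlib

open scoped Matrix Topology

noncomputable section

namespace Minkowski

/-! ### Minkowski three-space -/

/-- The vector space underlying Minkowski space `L³`; coordinates `0, 1, 2` are `X₁, X₂, X₃`. -/
abbrev L3 : Type := Fin 3 → ℝ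

/-- The Lorentzian product `v₁w₁ + v₂w₂ - v₃w₃`. -/
def lor (v w : L3) : ℝ := v 0 * w 0 + v 1 * w 1 - v 2 * w 2

/-- The Lorentzian cross product, characterised by `⟨a × b, c⟩ = det (a, b, c)`. -/
def cross (a b : L3) : L3 :=
  ![a 1 * b 2 - a 2 * b 1, a 2 * b 0 - a 0 * b 2, -(a 0 * b 1 - a 1 * b 0)]

theorem lor_cross (a b c : L3) : lor (cross a b) c = Matrix.det !![a 0, a 1, a 2;
    b 0, b 1, b 2; c 0, c 1, c 2] := by
  simp [lor, cross, Matrix.det_fin_three]; ring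

/-- `SO⁺(2,1)`: the linear isometries of `L³` preserving the orientations of space and of time. -/
def SOplus21 : Set (Matrix (Fin 3) (Fin 3) ℝ) :=
  {R | R * Matrix.diagonal ![1, 1, -1] * Rᵀ = Matrix.diagonal ![1, 1, -1] ∧ R.det = 1 ∧ 0 < R 2 2}

/-- The hyperbolic half-turn about the line directed by the unit spacelike vector `u`: it is the
identity on `ℝ u` and minus the identity on the Lorentz-orthogonal plane. -/
def halfTurn (u v : L3) : L3 := (2 * lor v u) • u - v

/-- `R` is a direct isometry with timelike axis `δ` and angle `φ`: it lies in `SO⁺(2,1)`, fixes the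
timelike vector `δ`, and has the eigenvalues `1, e^{iφ}, e^{-iφ}` with multiplicities. -/
def IsTimelikeRotation (R : Matrix (Fin 3) (Fin 3) ℝ) (δ : L3) (φ : ℝ) : Prop :=
  R ∈ SOplus21 ∧ lor δ δ < 0 ∧ R *ᵥ δ = δ ∧
    (R.map Complex.ofReal).charpoly =
      (Polynomial.X - Polynomial.C 1) *
        (Polynomial.X - Polynomial.C (Complex.exp (φ * Complex.I))) *
        (Polynomial.X - Polynomial.C (Complex.exp (-(φ * Complex.I))))

/-! ### The group `SU(1,1)`, the set `SU⁻(1,1)` and the spin covering -/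

/-- The group `SU(1,1)`. -/
def SU11 : Set (Matrix (Fin 2) (Fin 2) ℂ) :=
  {A | A.det = 1 ∧ Aᴴ * !![1, 0; 0, -1] * A = !![1, 0; 0, -1]}

/-- The matrix `J`. -/
def matJ : Matrix (Fin 2) (Fin 2) ℂ := !![0, Complex.I; Complex.I, 0]

/-- `SU⁻(1,1) = SU(1,1) · J`. -/
def SU11minus : Set (Matrix (Fin 2) (Fin 2) ℂ) := {B | ∃ A ∈ SU11, B = A * matJ}

/-- The identification of `L³` with Hermitian matrices with equal diagonal entries. -/
def hermMat (v : L3) : Matrix (Fin 2) (Fin 2) ℂ :=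
  !![(v 2 : ℂ), (v 1 : ℂ) + Complex.I * v 0; (v 1 : ℂ) - Complex.I * v 0, (v 2 : ℂ)]

/-- The spin covering on `SU(1,1)`: `R` is the map `R_A : M ↦ Aᴴ M A`. -/
def IsSpinImage (A : Matrix (Fin 2) (Fin 2) ℂ) (R : L3 → L3) : Prop :=
  ∀ v, hermMat (R v) = Aᴴ * hermMat v * A

/-- The extension of the spin covering to `SU⁻(1,1)`, with values in the determinant one
time-reversing isometries: `R` is the map `M ↦ -Aᴴ M A`. The sign is forced: `SU⁻(1,1)` has to be
mapped into determinant one isometries (for instance `J` to the half-turn about the first axis),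
and `(G, H) A` has to be Weierstrass data of the image surface. -/
def IsSpinImageMinus (A : Matrix (Fin 2) (Fin 2) ℂ) (R : L3 → L3) : Prop :=
  ∀ v, hermMat (R v) = -(Aᴴ * hermMat v * A)

/-! ### Maxfaces on the upper half-plane and their Weierstrass data -/

/-- The open upper half-plane, as a subset of `ℂ`. -/
def upperHalf : Set ℂ := {x | 0 < x.im}

/-- The complex derivative `∂X/∂x = (∂X/∂(Re x) - i ∂X/∂(Im x)) / 2`. -/
def dX (X : ℂ → L3) (x : ℂ) : Fin 3 → ℂ := fun k =>
  (((fderiv ℝ X x 1 k : ℝ) : ℂ) - Complex.I * ((fderiv ℝ X x Complex.I k : ℝ) : ℂ)) / 2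

/-- Maxfaces of disk-type: generalized maximal surfaces on the upper half-plane without (interior)
branch points. -/
structure IsMaxface (X : ℂ → L3) : Prop where
  differentiable : DifferentiableOn ℝ X upperHalf
  holomorphic : DifferentiableOn ℂ (dX X) upperHalf
  null : ∀ x ∈ upperHalf, dX X x 0 ^ 2 + dX X x 1 ^ 2 - dX X x 2 ^ 2 = 0
  nondegenerate : ∃ x ∈ upperHalf, ‖dX X x 0‖ ^ 2 + ‖dX X x 1‖ ^ 2 - ‖dX X x 2‖ ^ 2 ≠ 0
  no_branch : ∀ x ∈ upperHalf, dX X x ≠ 0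

/-- The integrand `(H² - G², i (G² + H²), 2 i G H)` of the spinor Weierstrass representation. -/
def weierstrassForm (G H : ℂ → ℂ) (x : ℂ) : Fin 3 → ℂ :=
  ![H x ^ 2 - G x ^ 2, Complex.I * (G x ^ 2 + H x ^ 2), 2 * Complex.I * G x * H x]

/-- `(G, H)` are Weierstrass data of `X` : `G`, `H` are holomorphic and `X = X₀ + Re ∫ ψ`, where
`ψ` is the Weierstrass integrand. The integral is written as a holomorphic primitive `F`, whose
additive constant accounts for `X₀`. -/
structure IsWeierstrassData (G H : ℂ → ℂ) (X : ℂ → L3) : Prop where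
  holomorphic_left : DifferentiableOn ℂ G upperHalf
  holomorphic_right : DifferentiableOn ℂ H upperHalf
  representation : ∃ F : ℂ → Fin 3 → ℂ,
    (∀ x ∈ upperHalf, HasDerivAt F (weierstrassForm G H x) x) ∧
    ∀ x ∈ upperHalf, ∀ k, X x k = (F x k).re

/-! ### Polygonal boundaries

Indices are cyclic: the `n + 3` edges and vertices are indexed by `Fin (n + 3)`, where index `i`
stands for number `i + 1`. The pre-images of the first `n + 2` vertices are the real numbers
`t 0 < ⋯ < t (n + 1)` and the pre-image of the last vertex is `∞`. -/

/-- The edge directions of a non-planar, non-degenerate, spacelike polygonal curve with `n + 3`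
vertices: unit spacelike vectors, consecutive ones having a timelike (in particular non-zero) cross
product, not all in one plane. -/
structure IsSpacelikeNonplanar {n : ℕ} (u : Fin (n + 3) → L3) : Prop where
  unit : ∀ i, lor (u i) (u i) = 1
  timelike_normal : ∀ i, lor (cross (u (i - 1)) (u i)) (cross (u (i - 1)) (u i)) < 0
  nonplanar : Submodule.span ℝ (Set.range u) = ⊤

/-- The unit normal `v i` at vertex number `i`: the vector `-u (i-1) × u i`, normalised
so that `⟨v i, v i⟩ = -1`. -/
def vertexNormal {n : ℕ} (u : Fin (n + 3) → L3) (i : Fin (n + 3)) : L3 :=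
  (Real.sqrt (-lor (cross (u (i - 1)) (u i)) (cross (u (i - 1)) (u i))))⁻¹ •
    (-cross (u (i - 1)) (u i))

/-- The number `θ i` such that `π θ i` is the angle between `u (i-1)` and `u i`. -/
def exteriorAngle {n : ℕ} (u : Fin (n + 3) → L3) (i : Fin (n + 3)) : ℝ :=
  Real.arccos (lor (u (i - 1)) (u i)) / Real.pi

/-- The open interval of the real projective line between the pre-images of vertices `i` and
`i + 1`: `(t i, t (i+1))`, then `(t (n+1), ∞)`, then `(∞, t 0)`, that is `(-∞, t 0)`. -/
def edgeInterval {n : ℕ} (t : Fin (n + 2) → ℝ) (i : Fin (n + 3)) : Set ℝ :=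
  if h : i.val < n + 1 then
    Set.Ioo (t ⟨i.val, by omega⟩) (t ⟨i.val + 1, by omega⟩)
  else if i.val = n + 1 then Set.Ioi (t (Fin.last (n + 1)))
  else Set.Iio (t 0)

/-- `X` is a maxface of disk-type which extends continuously to the closed upper half-plane and to
`∞` (with value at `∞` a point of `L³`, or the point at infinity when the curve is unclosed), whose
boundary values parametrize homeomorphically each edge, in the direction `u i`, of a polygonal
curve whose vertices have the pre-images `t 0 < ⋯ < t (n+1)` and `∞`, and which has no boundary
branch point inside the edges. -/
structure IsPolygonalMaxface {n : ℕ} (u : Fin (n + 3) → L3) (t : Fin (n + 2) → ℝ)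
    (X : ℂ → L3) : Prop where
  maxface : IsMaxface X
  strictMono : StrictMono t
  continuousOn : ContinuousOn X {x | 0 ≤ x.im}
  continuous_infty : ∃ a : OnePoint L3,
    Filter.Tendsto (fun x => (X x : OnePoint L3))
      (Filter.cocompact ℂ ⊓ Filter.principal {x | 0 ≤ x.im}) (𝓝 a)
  edge : ∀ i, ∃ (c : L3) (l : ℝ → ℝ), StrictMonoOn l (edgeInterval t i) ∧
    ∀ s ∈ edgeInterval t i, X (s : ℂ) = c + l s • u i
  no_boundary_branch : ∀ i, ∀ s ∈ edgeInterval t i,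
    ¬ Filter.Tendsto (dX X) (𝓝[upperHalf] (s : ℂ)) (𝓝 0)

/-! ### Monodromy -/

/-- Analytic continuation along the path `γ` leads from the germ of `f` at the starting point to the
germ of `g` at the end point. -/
def ContinuesAlong {a b : ℂ} (γ : Path a b) (f g : ℂ → Fin 2 → ℂ) : Prop :=
  ∃ F : unitInterval → ℂ → Fin 2 → ℂ,
    (∀ s, AnalyticAt ℂ (F s) (γ s)) ∧
    (∀ s, ∀ᶠ s' in 𝓝 s, F s' =ᶠ[𝓝 (γ s')] F s) ∧
    F 0 =ᶠ[𝓝 a] f ∧ F 1 =ᶠ[𝓝 b] g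

/-- `γ` is a simple loop around the pre-image of vertex `i`: from `x₀` in the upper half-plane,
it crosses edge interval `i - 1` downwards, and then comes back through edge interval `i`. -/
def IsVertexLoop {n : ℕ} (t : Fin (n + 2) → ℝ) (i : Fin (n + 3)) {x₀ : ℂ}
    (γ : Path x₀ x₀) : Prop :=
  ∃ s₁ s₂ : unitInterval, s₁ < s₂ ∧
    (∀ s, s < s₁ → 0 < (γ s).im) ∧
    (∃ r ∈ edgeInterval t (i - 1), γ s₁ = (r : ℂ)) ∧
    (∀ s, s₁ < s → s < s₂ → (γ s).im < 0) ∧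
    (∃ r ∈ edgeInterval t i, γ s₂ = (r : ℂ)) ∧
    (∀ s, s₂ < s → 0 < (γ s).im)

/-- `M` is a monodromy matrix of the row vector `(G, H)` along the loop `γ`: `(G, H)` can be
continued along `γ`, and it becomes `(G, H) M`. -/
def IsMonodromyMatrix (G H : ℂ → ℂ) {x₀ : ℂ} (γ : Path x₀ x₀)
    (M : Matrix (Fin 2) (Fin 2) ℂ) : Prop :=
  ContinuesAlong γ (fun x => ![G x, H x]) (fun x => ![G x, H x] ᵥ* M)

end Minkowski

end

/-!
The proof is a reflection argument. Write `W = (H² - G², i (G² + H²), 2 i G H)` for the Weierstrass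
integrand, `F` for its primitive, so that `X = Re F`, and let `u` be the direction of an edge.

*Extension of `W` across an edge.* The components of `u × X` are constant on the edge. By the
Schwarz reflection principle (`exists_analyticAt_of_re_eq_const`), the components `N` of `u × W`
extend analytically across the edge, with imaginary values on it. As `W` is null and `⟨u, u⟩ = 1`,
the remaining component `φ = ⟨u, W⟩` satisfies `φ² = ⟨N, N⟩`, so `φ²` extends with real values on
the edge. These values are non-negative: where `φ²` is negative, `φ` is imaginary and `⟨u, X⟩`
would be locally constant on the edge, whereas `X` moves strictly along it
(`eventually_const_of_sq_neg`). So the zeros of `φ²` on the edge have even order, `φ` extends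
(`exists_analyticAt_sq_eq_of_nonneg`), and with it `W = φ u + u × N`. On the edge the half-turn
about `u` maps `W` to its conjugate (`exists_analyticAt_weierstrassForm`).

*Extension of `(G, H)`.* Without boundary branch points `W` has no zero on the edge, so one of
`G²`, `H²` has an analytic square root, and `(G, H)` extends. A pair is determined up to sign by
`W`, so the half-turn relation becomes `(G, H) = ± conj (G, H) J D⁻¹` on the edge, where `D` is a
pre-image of the half-turn (`eq_conj_vecMul_or_eq_neg`). The sign is constant along the edge, and
is absorbed into the choice of `D` (`exists_forall_extendsAcross`). So `(G, H)` continues through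
edge `i` to `conj (G, H) (x̄) J Dᵢ⁻¹` in the lower half-plane.

*Monodromy.* Going down through edge `i - 1` and back through edge `i` multiplies `(G, H)` by `(J
Dᵢ⁻¹)⁻¹ (J Dᵢ₋₁⁻¹) = Dᵢ Dᵢ₋₁⁻¹` (`isMonodromyMatrix_mul_inv`). The matrix is unique because `G` and
`H` are linearly independent: otherwise `W` would be a function times a constant vector, and the
boundary curve would be planar (`linearIndependent_weierstrassData`). Finally `Dᵢ Dᵢ₋₁⁻¹` lies over
the product of two half-turns, a rotation about the common normal of their axes by twice their
angle (`isTimelikeRotation_halfTurnMat_mul`).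
-/

noncomputable section

namespace Minkowski

open Complex Set Filter Metric

/-! ### Reflection of holomorphic functions whose real part is constant on an interval -/

/-- Maximum principle for the real part `v` of a holomorphic function, when only `v` (and not the
holomorphic function) is continuous up to the boundary. -/
theorem re_nonpos_of_frontier_nonpos {U : Set ℂ} (hU : IsOpen U) (hUc : IsPreconnected U)
    (hUb : Bornology.IsBounded U) {f : ℂ → ℂ} {v : ℂ → ℝ} (hf : DifferentiableOn ℂ f U)
    (hv : ContinuousOn v (closure U)) (hfv : ∀ z ∈ U, v z = (f z).re)
    (hfr : ∀ z ∈ frontier U, v z ≤ 0) : ∀ z ∈ U, v z ≤ 0 := by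
  intro z hz
  obtain ⟨z₀, hz₀, hmax⟩ := hUb.isCompact_closure.exists_isMaxOn ⟨z, subset_closure hz⟩ hv
  refine (hmax (subset_closure hz)).trans ?_
  by_cases hz₀U : z₀ ∈ U
  · have hexp : ∀ w ∈ U, ‖Complex.exp (f w)‖ = Real.exp (v w) := fun w hw => by
      rw [Complex.norm_exp, hfv w hw]
    have hmax' : IsMaxOn (norm ∘ fun w => Complex.exp (f w)) U z₀ := by
      intro w hw
      simp only [mem_ofPred_eq, Function.comp_apply, hexp w hw, hexp z₀ hz₀U]
      exact Real.exp_le_exp.2 (hmax (subset_closure hw))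
    have hconst := Complex.norm_eqOn_of_isPreconnected_of_isMaxOn hUc hU hf.cexp hz₀U hmax'
    have hconst' : EqOn v (fun _ => v z₀) U := fun w hw => by
      have := hconst hw
      simp only [Function.comp_apply, Function.const_apply, hexp w hw, hexp z₀ hz₀U] at this
      exact Real.exp_injective this
    have hcl := hconst'.of_subset_closure hv continuousOn_const subset_closure subset_rfl
    obtain ⟨w, hw⟩ : (frontier U).Nonempty := by
      rw [nonempty_frontier_iff]
      refine ⟨⟨z, hz⟩, fun h => ?_⟩
      rw [h] at hUb
      exact NormedSpace.unbounded_univ ℝ ℂ hUb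
    have := hcl (frontier_subset_closure hw)
    simp only at this
    rw [← this]
    exact hfr w hw
  · exact hfr z₀ ⟨hz₀, by rwa [hU.interior_eq]⟩

theorem isOpen_upperHalf : IsOpen upperHalf := isOpen_lt continuous_const continuous_im

theorem isClosed_closedUpperHalf : IsClosed {x : ℂ | 0 ≤ x.im} :=
  isClosed_le continuous_const continuous_im

theorem convex_upperHalf : Convex ℝ upperHalf := convex_halfSpace_im_gt 0

/-- The barrier estimate: on the half-disc of radius one about the real point `a`, the function
`M ((x - a)² - y² + 2 y)` dominates `v`, so that `v` vanishes linearly at `a`. -/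
theorem re_le_barrier {f : ℂ → ℂ} {v : ℂ → ℝ} (hf : DifferentiableOn ℂ f upperHalf)
    (hv : ContinuousOn v {x | 0 ≤ x.im}) (hfv : ∀ z ∈ upperHalf, v z = (f z).re) {a M : ℝ}
    (hM : ∀ z ∈ closedBall (a : ℂ) 1, 0 ≤ z.im → v z ≤ M)
    (h0 : ∀ x : ℝ, |x - a| ≤ 1 → v x = 0) {z : ℂ} (hre : z.re = a) (hz0 : 0 < z.im)
    (hz1 : z.im < 1) : v z ≤ 2 * M * z.im := by
  have hM0 : 0 ≤ M := by
    have h1 := hM a (by simp) (by simp)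
    rwa [h0 a (by simp)] at h1
  set U : Set ℂ := ball (a : ℂ) 1 ∩ upperHalf with hUdef
  have hUo : IsOpen U := isOpen_ball.inter isOpen_upperHalf
  have hUcl : closure U ⊆ closedBall (a : ℂ) 1 ∩ {x | 0 ≤ x.im} :=
    closure_minimal (fun w hw => ⟨ball_subset_closedBall hw.1, le_of_lt (show 0 < w.im from hw.2)⟩)
      (isClosed_closedBall.inter isClosed_closedUpperHalf)
  have hsq : ∀ w : ℂ, ‖w - a‖ ^ 2 = (w.re - a) ^ 2 + w.im ^ 2 := fun w => by
    rw [Complex.sq_norm, Complex.normSq_apply]; simp; ring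
  have key := re_nonpos_of_frontier_nonpos hUo
    (((convex_ball (a : ℂ) 1).inter convex_upperHalf).isPreconnected)
    (isBounded_ball.subset inter_subset_left)
    (f := fun w => f w - M * ((w - a) ^ 2 - 2 * I * (w - a)))
    (v := fun w => v w - M * ((w.re - a) ^ 2 - w.im ^ 2 + 2 * w.im))
    ((hf.mono inter_subset_right).sub (by fun_prop))
    ((hv.mono fun w hw => (hUcl hw).2).sub (by fun_prop))
    (fun w hw => by rw [hfv w hw.2]; simp [pow_two])
    (fun w hw => by
      obtain ⟨hw1, hw2⟩ := hUcl hw.1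
      have hw2' : 0 ≤ w.im := hw2
      have hn : ‖w - a‖ ≤ 1 := by simpa [dist_eq_norm] using hw1
      have hs := hsq w
      rcases hw2'.eq_or_lt with him | him
      · have hwr : w = (w.re : ℂ) := Complex.ext (by simp) (by simp [← him])
        have hvw : v w = 0 := by
          rw [hwr]
          refine h0 _ (abs_le_of_sq_le_sq ?_ zero_le_one)
          rw [← him] at hs; nlinarith [norm_nonneg (w - a)]
        rw [hvw, ← him]
        nlinarith [mul_nonneg hM0 (sq_nonneg (w.re - a))]
      · have hn1 : ‖w - a‖ = 1 := by
          by_contra hne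
          refine hw.2 ?_
          rw [hUo.interior_eq]
          exact ⟨by simpa [dist_eq_norm] using lt_of_le_of_ne hn hne, him⟩
        rw [hn1] at hs
        have hvM := hM w hw1 hw2
        have h1 : w.im ≤ 1 := by nlinarith [sq_nonneg (w.re - a)]
        nlinarith [mul_nonneg hM0 (mul_nonneg hw2' (sub_nonneg.2 h1))])
    z ⟨by
      have : ‖z - a‖ ^ 2 < 1 := by rw [hsq, hre]; nlinarith
      have h2 : ‖z - a‖ < 1 := by nlinarith [norm_nonneg (z - a)]
      simpa [dist_eq_norm] using h2, hz0⟩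
  simp only [hre, sub_self] at key
  nlinarith [mul_nonneg hM0 (sq_nonneg z.im)]

/-- A bound of the derivative of a holomorphic function by its real part. -/
theorem norm_deriv_le_of_abs_re_le {f : ℂ → ℂ} {z : ℂ} {R B : ℝ} (hR : 0 < R) (hB : 0 < B)
    (hf : DifferentiableOn ℂ f (ball z R)) (hre : ∀ w ∈ ball z R, |(f w).re| ≤ B) :
    ‖deriv f z‖ ≤ 8 * B / R := by
  set g : ℂ → ℂ := fun w => f (z + w) - f z with hg
  have hmaps : ∀ w ∈ ball (0 : ℂ) R, z + w ∈ ball z R := fun w hw => by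
    simpa [dist_eq_norm] using hw
  have hgd : DifferentiableOn ℂ g (ball 0 R) :=
    (hf.comp (by fun_prop : DifferentiableOn ℂ (fun w : ℂ => z + w) (ball 0 R)) hmaps).sub_const _
  have hbound : ∀ w ∈ ball (0 : ℂ) R, ‖g w‖ ≤ 2 * (2 * B) * ‖w‖ / (R - ‖w‖) := fun w hw => by
    refine borelCaratheodory_zero (by positivity) hgd (fun x hx => ?_) hR hw (by simp [hg])
    have h1 := abs_le.1 (hre _ (hmaps x hx))
    have h2 := abs_le.1 (hre z (mem_ball_self hR))
    simp only [hg, mem_ofPred_eq, sub_re]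
    linarith
  have hcl : closure (ball (0 : ℂ) (R / 2)) ⊆ ball 0 R := by
    refine closure_ball_subset_closedBall.trans (closedBall_subset_ball (by linarith))
  have hd := norm_deriv_le_of_forall_mem_sphere_norm_le (c := (0 : ℂ)) (f := g) (C := 4 * B)
    (half_pos hR) ((hgd.mono hcl).diffContOnCl) (fun w hw => by
      have hw' : ‖w‖ = R / 2 := by simpa using hw
      refine (hbound w (by simp [hw']; linarith)).trans (le_of_eq ?_)
      rw [hw']; field_simp; ring)
  have hde : deriv g 0 = deriv f z := by
    simp only [hg, deriv_sub_const]
    rw [deriv_comp_const_add, add_zero]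
  rw [hde] at hd
  refine hd.trans (le_of_eq ?_)
  field_simp; ring

/-- A continuous function on a disc that is holomorphic off the real axis is holomorphic, by
Morera's theorem. -/
theorem differentiableOn_ball_of_off_real {h : ℂ → ℂ} {r : ℝ} (hc : ContinuousOn h (ball 0 r))
    (hd : ∀ z ∈ ball (0 : ℂ) r, z.im ≠ 0 → DifferentiableAt ℂ h z) :
    DifferentiableOn ℂ h (ball 0 r) := by
  refine (isConservativeOn_and_continuousOn_iff_isDifferentiableOn isOpen_ball).1 ⟨?_, hc⟩
  intro z w hzw
  have hmem : ∀ x ∈ uIcc z.re w.re, ∀ y ∈ uIcc z.im w.im, (x + y * I : ℂ) ∈ ball (0 : ℂ) r :=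
    fun x hx y hy => hzw (by
      rw [Rectangle, mem_reProdIm]; simpa using ⟨hx, hy⟩)
  -- the rectangle is cut, or extended, along the real axis
  have hmem0 : ∀ x ∈ uIcc z.re w.re, ∀ y ∈ uIcc z.im w.im, ∀ y' ∈ uIcc 0 y,
      (x + y' * I : ℂ) ∈ ball (0 : ℂ) r := fun x hx y hy y' hy' => by
    have h1 := hmem x hx y hy
    rw [mem_ball_zero_iff] at h1 ⊢
    refine lt_of_le_of_lt ?_ h1
    have hyy : y' ^ 2 ≤ y ^ 2 := sq_le_sq.2 (by
      rcases mem_uIcc.1 hy' with h | h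
      · rw [abs_of_nonneg h.1, abs_of_nonneg (h.1.trans h.2)]; exact h.2
      · rw [abs_of_nonpos h.2, abs_of_nonpos (h.1.trans h.2)]; linarith)
    rw [Complex.norm_add_mul_I, Complex.norm_add_mul_I]
    exact Real.sqrt_le_sqrt (by linarith)
  have hhalf : ∀ d ∈ uIcc z.im w.im,
      (∫ x : ℝ in z.re..w.re, h (x + (0 : ℝ) * I)) - (∫ x : ℝ in z.re..w.re, h (x + d * I)) +
      I • (∫ y : ℝ in (0 : ℝ)..d, h (w.re + y * I)) -
      I • (∫ y : ℝ in (0 : ℝ)..d, h (z.re + y * I)) = 0 := fun d hdm => by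
    have := integral_boundary_rect_eq_zero_of_continuousOn_of_differentiableOn h
      ((z.re : ℂ)) (w.re + d * I) (hc.mono ?_) ?_
    · simpa using this
    · intro q hq
      rw [mem_reProdIm] at hq
      have := hmem0 q.re (by simpa using hq.1) d hdm q.im (by simpa using hq.2)
      rwa [re_add_im] at this
    · intro q hq
      rw [mem_reProdIm] at hq
      have h1 : q.re ∈ Ioo (min z.re w.re) (max z.re w.re) := by simpa using hq.1
      have h2 : q.im ∈ Ioo (min 0 d) (max 0 d) := by simpa using hq.2
      have hqm := hmem0 q.re (Ioo_subset_Icc_self h1) d hdm q.im (Ioo_subset_Icc_self h2)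
      rw [re_add_im] at hqm
      refine (hd q hqm fun h0 => ?_).differentiableWithinAt
      rw [h0] at h2
      rcases le_total 0 d with h | h
      · simp [h] at h2
      · simp [h] at h2
  have hint : ∀ x ∈ uIcc z.re w.re, ∀ d ∈ uIcc z.im w.im,
      IntervalIntegrable (fun y : ℝ => h (x + y * I)) MeasureTheory.volume 0 d :=
    fun x hx d hd' => ContinuousOn.intervalIntegrable (hc.comp (by fun_prop)
      fun y hy => hmem0 x hx d hd' y hy)
  have e1 := hhalf _ left_mem_uIcc
  have e2 := hhalf _ right_mem_uIcc
  have hsplit : ∀ x ∈ uIcc z.re w.re, (∫ y : ℝ in z.im..w.im, h (x + y * I)) =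
      (∫ y : ℝ in (0 : ℝ)..w.im, h (x + y * I)) - ∫ y : ℝ in (0 : ℝ)..z.im, h (x + y * I) :=
    fun x hx => (intervalIntegral.integral_interval_sub_left (hint x hx _ right_mem_uIcc)
      (hint x hx _ left_mem_uIcc)).symm
  rw [← add_eq_zero_iff_eq_neg, wedgeIntegral_add_wedgeIntegral_eq, hsplit _ right_mem_uIcc,
    hsplit _ left_mem_uIcc]
  simp only [smul_sub]
  linear_combination e2 - e1

/-- The reflection principle at unit scale. The barrier makes `v` vanish linearly on the real axis,
so that the derivative of `f` is bounded; hence `f` extends continuously to the real axis, and `z ↦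
-conj (f (conj z))` continues it to the lower half-disc. -/
theorem exists_differentiableOn_ball_of_re_eq_zero {f : ℂ → ℂ} {v : ℂ → ℝ}
    (hf : DifferentiableOn ℂ f upperHalf) (hv : ContinuousOn v {x | 0 ≤ x.im})
    (hfv : ∀ z ∈ upperHalf, v z = (f z).re) (h0 : ∀ x : ℝ, |x| ≤ 2 → v x = 0) :
    ∃ p : ℂ → ℂ, DifferentiableOn ℂ p (ball 0 (1 / 2)) ∧
      ∀ z ∈ ball (0 : ℂ) (1 / 2) ∩ upperHalf, p z = f z := by
  obtain ⟨M, hM0, hM⟩ : ∃ M : ℝ, 0 < M ∧ ∀ z ∈ closedBall (0 : ℂ) 2, 0 ≤ z.im → |v z| ≤ M := by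
    obtain ⟨C, hC⟩ := ((isCompact_closedBall (0 : ℂ) 2).inter_right
      isClosed_closedUpperHalf).exists_bound_of_continuousOn (hv.mono inter_subset_right)
    exact ⟨max C 1, by positivity, fun z h1 h2 => (hC z ⟨h1, h2⟩).trans (le_max_left _ _)⟩
  have hlin : ∀ z : ℂ, |z.re| ≤ 1 → 0 < z.im → z.im < 1 → |v z| ≤ 2 * M * z.im := by
    intro z hz1 hz2 hz3
    have hball : ∀ w ∈ closedBall (z.re : ℂ) 1, w ∈ closedBall (0 : ℂ) 2 := fun w hw => by
      have h1 : ‖(z.re : ℂ)‖ ≤ 1 := by simpa using hz1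
      have h2 : ‖w - z.re‖ ≤ 1 := by simpa [dist_eq_norm] using hw
      rw [mem_closedBall_zero_iff]
      calc ‖w‖ = ‖(w - z.re) + z.re‖ := by simp
        _ ≤ 2 := (norm_add_le _ _).trans (by linarith)
    have habs : ∀ x : ℝ, |x - z.re| ≤ 1 → v x = 0 := fun x hx => h0 x (by
      rw [abs_le] at *; constructor <;> linarith)
    have h1 := re_le_barrier hf hv hfv (a := z.re) (M := M)
      (fun w hw hw' => (le_abs_self _).trans (hM w (hball w hw) hw')) habs rfl hz2 hz3
    have h2 := re_le_barrier hf.neg hv.neg (fun w hw => by simp [hfv w hw]) (a := z.re) (M := M)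
      (fun w hw hw' => (neg_le_abs _).trans (hM w (hball w hw) hw'))
      (fun x hx => by simp [habs x hx]) rfl hz2 hz3
    exact abs_le.2 ⟨by simp only [Pi.neg_apply] at h2; linarith, h1⟩
  set S : Set ℂ := ball (0 : ℂ) (1 / 2) ∩ upperHalf with hS
  have hSo : IsOpen S := isOpen_ball.inter isOpen_upperHalf
  -- on the disc of radius `z.im` about `z`, the real part of `f` is at most `4 M z.im`
  have hder : ∀ z ∈ S, ‖deriv f z‖ ≤ 32 * M := fun z hz => by
    have hzi : 0 < z.im := hz.2
    have hzn : ‖z‖ < 1 / 2 := by simpa using hz.1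
    have hw : ∀ w ∈ ball z z.im, 0 < w.im ∧ |w.re| ≤ 1 ∧ w.im < 2 * z.im ∧ w.im < 1 :=
      fun w hw => by
        have h1 : ‖w - z‖ < z.im := by simpa [dist_eq_norm] using hw
        have h2 := abs_lt.1 ((abs_im_le_norm (w - z)).trans_lt h1)
        have h3 := abs_le.1 ((abs_re_le_norm (w - z)).trans h1.le)
        have h4 := abs_le.1 ((abs_im_le_norm z).trans hzn.le)
        have h5 := abs_le.1 ((abs_re_le_norm z).trans hzn.le)
        simp only [sub_im, sub_re] at h2 h3
        exact ⟨by linarith, abs_le.2 ⟨by linarith, by linarith⟩, by linarith, by linarith⟩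
    have := norm_deriv_le_of_abs_re_le (B := 4 * M * z.im) hzi (by positivity)
      (hf.mono fun w h => (hw w h).1) (fun w h => by
        obtain ⟨a1, a2, a3, a4⟩ := hw w h
        rw [← hfv w a1]
        refine (hlin w a2 a1 a4).trans ?_
        nlinarith)
    refine this.trans (le_of_eq ?_)
    field_simp; ring
  have hlip : LipschitzOnWith (Real.toNNReal (32 * M)) f S :=
    Convex.lipschitzOnWith_of_nnnorm_deriv_le
      (fun z hz => hf.differentiableAt (isOpen_upperHalf.mem_nhds hz.2))
      (fun z hz => by
        rw [← NNReal.coe_le_coe, coe_nnnorm, Real.coe_toNNReal _ (by positivity)]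
        exact hder z hz)
      ((convex_ball (0 : ℂ) (1 / 2)).inter convex_upperHalf)
  obtain ⟨g, hg, hfg⟩ := hlip.extend_finite_dimension
  have hgc : Continuous g := hg.continuous
  have hclS : ball (0 : ℂ) (1 / 2) ∩ {x | 0 ≤ x.im} ⊆ closure S := by
    intro z hz
    rw [hS, mem_closure_iff_nhds]
    intro V hV
    have : ∀ᶠ e : ℝ in 𝓝[>] 0, z + e * I ∈ V ∩ ball (0 : ℂ) (1 / 2) := by
      have hcont : Tendsto (fun e : ℝ => z + e * I) (𝓝 0) (𝓝 z) := by
        have : Continuous fun e : ℝ => z + e * I := by fun_prop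
        simpa using this.tendsto 0
      exact (hcont.mono_left nhdsWithin_le_nhds).eventually
        (inter_mem hV (isOpen_ball.mem_nhds hz.1))
    obtain ⟨e, he, he0⟩ := (this.and self_mem_nhdsWithin).exists
    refine ⟨z + e * I, he.1, he.2, ?_⟩
    have : 0 ≤ z.im := hz.2
    have : 0 < e := he0
    simp only [upperHalf, mem_ofPred_eq, add_im, mul_im, ofReal_re, I_im, ofReal_im, I_re]
    linarith
  -- the continuous extension `g` of `f` has real part `v`, hence is imaginary on the real axis
  have hreg : EqOn v (fun z => (g z).re) (ball (0 : ℂ) (1 / 2) ∩ {x | 0 ≤ x.im}) := by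
    refine EqOn.of_subset_closure (s := S) (fun z hz => ?_) (hv.mono inter_subset_right)
      (by fun_prop) (fun z hz => ⟨hz.1, le_of_lt (show 0 < z.im from hz.2)⟩) hclS
    rw [hfv z hz.2, hfg hz]
  have hreal : ∀ z ∈ ball (0 : ℂ) (1 / 2), z.im = 0 → (g z).re = 0 := fun z hz him => by
    rw [← show v z = (g z).re from hreg ⟨hz, him.ge⟩]
    have : z = (z.re : ℂ) := Complex.ext (by simp) (by simp [him])
    rw [this]
    refine h0 _ ((abs_re_le_norm z).trans ?_)
    have : ‖z‖ < 1 / 2 := by simpa using hz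
    linarith
  set h : ℂ → ℂ := fun z => if 0 ≤ z.im then g z else -(starRingEnd ℂ) (g ((starRingEnd ℂ) z))
    with hh
  refine ⟨h, differentiableOn_ball_of_off_real ?_ ?_, fun z hz => ?_⟩
  · refine ContinuousOn.if ?_ hgc.continuousOn (by fun_prop)
    rintro z ⟨hz, hzf⟩
    have him : z.im = 0 := by
      have hfr := frontier_le_subset_eq (continuous_const (y := (0 : ℝ))) continuous_im hzf
      exact (show (0 : ℝ) = z.im from hfr).symm
    have hzz : (starRingEnd ℂ) z = z := conj_eq_iff_im.2 him
    rw [hzz]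
    exact Complex.ext (by simp [hreal z hz him]) (by simp)
  · intro z hz him
    rcases lt_or_gt_of_ne him with hlt | hgt
    · have hev : h =ᶠ[𝓝 z] fun z => -(starRingEnd ℂ) (f ((starRingEnd ℂ) z)) := by
        filter_upwards [(isOpen_ball.inter (isOpen_lt continuous_im continuous_const)).mem_nhds
          (⟨hz, hlt⟩ : z ∈ ball (0 : ℂ) (1 / 2) ∩ {z | z.im < 0})] with w hw
        have hw2 : w.im < 0 := hw.2
        have hmem : (starRingEnd ℂ) w ∈ S := ⟨by simpa using hw.1, by simpa [upperHalf] using hw2⟩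
        simp only [hh, not_le.2 hw2, if_false, hfg hmem]
      rw [hev.differentiableAt_iff]
      have : DifferentiableAt ℂ f ((starRingEnd ℂ) z) :=
        hf.differentiableAt (isOpen_upperHalf.mem_nhds (by simpa [upperHalf] using hlt))
      exact (differentiableAt_conj_conj_iff.2 this).neg
    · have hev : h =ᶠ[𝓝 z] f := by
        filter_upwards [hSo.mem_nhds ⟨hz, hgt⟩] with w hw
        have hw2 : 0 < w.im := hw.2
        simp only [hh, hw2.le, if_true, hfg hw]
      rw [hev.differentiableAt_iff]
      exact hf.differentiableAt (isOpen_upperHalf.mem_nhds hgt)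
  · have hw2 : 0 < z.im := hz.2
    simp only [hh, hw2.le, if_true, hfg hz]

/-- The Schwarz reflection principle: a function holomorphic in the upper half-plane whose real part
is continuous up to the real axis and constant near the real point `s` extends analytically to a
neighbourhood of `s`. -/
theorem exists_analyticAt_of_re_eq_const {f : ℂ → ℂ} {v : ℂ → ℝ} {s c : ℝ}
    (hf : DifferentiableOn ℂ f upperHalf) (hv : ContinuousOn v {x | 0 ≤ x.im})
    (hfv : ∀ z ∈ upperHalf, v z = (f z).re) (hc : ∀ᶠ x : ℝ in 𝓝 s, v x = c) :
    ∃ p : ℂ → ℂ, AnalyticAt ℂ p s ∧ ∀ᶠ z in 𝓝[upperHalf] (s : ℂ), p z = f z := by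
  obtain ⟨R, hR, hRc⟩ := Metric.eventually_nhds_iff.1 hc
  set k : ℝ := R / 4 with hk
  have hk0 : 0 < k := by positivity
  have him : ∀ z : ℂ, (s + k * z : ℂ).im = k * z.im := fun z => by simp
  obtain ⟨p, hp, hpf⟩ := exists_differentiableOn_ball_of_re_eq_zero
    (f := fun z => f (s + k * z) - c) (v := fun z => v (s + k * z) - c)
    ((hf.comp (by fun_prop : DifferentiableOn ℂ (fun z : ℂ => (s + k * z : ℂ)) upperHalf)
      fun z hz => by
        have : 0 < z.im := hz
        simp only [upperHalf, mem_ofPred_eq, him]; positivity).sub_const _)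
    ((hv.comp (by fun_prop : ContinuousOn (fun z : ℂ => (s + k * z : ℂ)) {x | 0 ≤ x.im})
      fun z hz => by
        have : 0 ≤ z.im := hz
        simp only [mem_ofPred_eq, him]; positivity).sub continuousOn_const)
    (fun z hz => by
      have : 0 < z.im := hz
      rw [hfv _ (by simp only [upperHalf, mem_ofPred_eq, him]; positivity)]; simp)
    (fun x hx => by
      have := @hRc (s + k * x) (by
        rw [Real.dist_eq, add_sub_cancel_left, abs_mul, abs_of_pos hk0, hk]
        nlinarith)
      push_cast at this
      rw [this, sub_self])
  have hmaps : ∀ᶠ z : ℂ in 𝓝 (s : ℂ), (z - s) / k ∈ ball (0 : ℂ) (1 / 2) := by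
    have hcont : ContinuousAt (fun z : ℂ => (z - s) / k) s := by fun_prop
    exact hcont.eventually_mem (isOpen_ball.mem_nhds (by simp))
  refine ⟨fun z => p ((z - s) / k) + c, ?_, ?_⟩
  · have h1 : AnalyticAt ℂ p ((s - s) / k) :=
      hp.analyticAt (isOpen_ball.mem_nhds (by simp))
    exact (h1.comp_of_eq (f := fun z : ℂ => (z - s) / k) (by fun_prop) rfl).add analyticAt_const
  · filter_upwards [nhdsWithin_le_nhds hmaps, self_mem_nhdsWithin] with z hz hzu
    have hzu' : 0 < z.im := hzu
    have hkc : (k : ℂ) ≠ 0 := by exact_mod_cast hk0.ne'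
    have := hpf ((z - s) / k) ⟨hz, by
      simp only [upperHalf, mem_ofPred_eq, div_ofReal_im, sub_im, ofReal_im, sub_zero]
      positivity⟩
    rw [this, mul_div_cancel₀ _ hkc]
    ring_nf

/-! ### Germs of analytic functions at a point of the real axis -/

instance neBot_nhdsWithin_upperHalf (s : ℝ) : (𝓝[upperHalf] (s : ℂ)).NeBot := by
  rw [← mem_closure_iff_nhdsWithin_neBot, upperHalf, closure_setOfPred_lt_im]
  simp

theorem upperHalf_subset_compl_singleton (s : ℝ) : upperHalf ⊆ {(s : ℂ)}ᶜ := by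
  rintro z hz rfl
  simp [upperHalf] at hz

section Identity

variable {E : Type*} [NormedAddCommGroup E] [NormedSpace ℂ E]

theorem eventuallyEq_of_frequently_upperHalf {p q : ℂ → E} {s : ℝ} (hp : AnalyticAt ℂ p s)
    (hq : AnalyticAt ℂ q s) (h : ∃ᶠ z in 𝓝[upperHalf] (s : ℂ), p z = q z) : p =ᶠ[𝓝 (s : ℂ)] q :=
  (hp.frequently_eq_iff_eventually_eq hq).1
    (h.filter_mono (nhdsWithin_mono _ (upperHalf_subset_compl_singleton s)))

theorem eventually_eq_or_eq_neg_of_real {p q : ℂ → E} {s : ℝ} (hp : AnalyticAt ℂ p s)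
    (hq : AnalyticAt ℂ q s) (h : ∀ᶠ x : ℝ in 𝓝 s, p x = q x ∨ p x = -q x) :
    p =ᶠ[𝓝 (s : ℂ)] q ∨ p =ᶠ[𝓝 (s : ℂ)] -q := by
  have htend : Tendsto (fun x : ℝ => (x : ℂ)) (𝓝[≠] s) (𝓝[≠] (s : ℂ)) :=
    tendsto_nhdsWithin_iff.2 ⟨(continuous_ofReal.tendsto s).mono_left nhdsWithin_le_nhds,
      by filter_upwards [self_mem_nhdsWithin] with x hx; simpa using hx⟩
  have h1 : ∃ᶠ z in 𝓝[≠] (s : ℂ), p z = q z ∨ p z = (-q) z :=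
    htend.frequently (h.filter_mono nhdsWithin_le_nhds).frequently
  rcases frequently_or_distrib.1 h1 with h2 | h2
  · exact Or.inl ((hp.frequently_eq_iff_eventually_eq hq).1 h2)
  · exact Or.inr ((hp.frequently_eq_iff_eventually_eq hq.neg).1 h2)

/-- If the values of `f` above a real point are pointwise those of `g` or of `-g`, then one sign
serves for all points nearby, because half-discs are connected. -/
theorem eventually_eq_or_eq_neg_of_upperHalf {f g : ℂ → ℂ} {s : ℝ}
    (hf : DifferentiableOn ℂ f upperHalf) (hg : AnalyticAt ℂ g s)
    (h : ∀ᶠ z in 𝓝[upperHalf] (s : ℂ), f z = g z ∨ f z = -g z) :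
    (∀ᶠ z in 𝓝[upperHalf] (s : ℂ), f z = g z) ∨ ∀ᶠ z in 𝓝[upperHalf] (s : ℂ), f z = -g z := by
  rw [eventually_nhdsWithin_iff] at h
  obtain ⟨r, hr, hball⟩ := Metric.eventually_nhds_iff_ball.1 (hg.eventually_analyticAt.and h)
  set U := ball (s : ℂ) r ∩ upperHalf with hU
  have hUo : IsOpen U := isOpen_ball.inter isOpen_upperHalf
  have hUc : IsPreconnected U := ((convex_ball (s : ℂ) r).inter convex_upperHalf).isPreconnected
  have hUm : U ∈ 𝓝[upperHalf] (s : ℂ) :=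
    inter_mem (nhdsWithin_le_nhds (ball_mem_nhds _ hr)) self_mem_nhdsWithin
  have hfa : AnalyticOnNhd ℂ f U := (hf.mono inter_subset_right).analyticOnNhd hUo
  have hga : AnalyticOnNhd ℂ g U := fun z hz => (hball z hz.1).1
  obtain ⟨z₀, hz₀⟩ : U.Nonempty := (neBot_nhdsWithin_upperHalf s).nonempty_of_mem hUm
  have h1 : ∃ᶠ z in 𝓝[≠] z₀, f z = g z ∨ f z = (-g) z := by
    refine Eventually.frequently (nhdsWithin_le_nhds ?_)
    filter_upwards [hUo.mem_nhds hz₀] with z hz using (hball z hz.1).2 hz.2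
  rcases frequently_or_distrib.1 h1 with h2 | h2
  · exact Or.inl (mem_of_superset hUm
      (hfa.eqOn_of_preconnected_of_frequently_eq hga hUc hz₀ h2))
  · exact Or.inr (mem_of_superset hUm
      (hfa.eqOn_of_preconnected_of_frequently_eq hga.neg hUc hz₀ h2))

end Identity

/-- Boundary values agree with those of an analytic extension. -/
theorem eventually_real_eq_re {v : ℂ → ℝ} {p : ℂ → ℂ} {s : ℝ}
    (hv : ContinuousOn v {x | 0 ≤ x.im}) (hp : AnalyticAt ℂ p s)
    (h : ∀ᶠ z in 𝓝[upperHalf] (s : ℂ), v z = (p z).re) : ∀ᶠ x : ℝ in 𝓝 s, v x = (p x).re := by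
  have h1 := eventually_eventually_nhds.2 (eventually_nhdsWithin_iff.1 h)
  filter_upwards [continuous_ofReal.continuousAt.eventually (h1.and hp.eventually_analyticAt)]
    with x hx
  have e1 : Tendsto v (𝓝[upperHalf] (x : ℂ)) (𝓝 (v x)) :=
    (hv x (by simp)).mono_left (nhdsWithin_mono _ fun z hz => le_of_lt (show 0 < z.im from hz))
  have e2 : Tendsto (fun z => (p z).re) (𝓝[upperHalf] (x : ℂ)) (𝓝 (p x).re) :=
    (continuous_re.continuousAt.comp hx.2.continuousAt).mono_left nhdsWithin_le_nhds
  refine tendsto_nhds_unique e1 (e2.congr' ?_)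
  filter_upwards [eventually_nhdsWithin_iff.2 hx.1] with z hz using hz.symm

theorem eventually_re_deriv_eq_zero {p : ℂ → ℂ} {s c : ℝ} (hp : AnalyticAt ℂ p s)
    (h : ∀ᶠ x : ℝ in 𝓝 s, (p x).re = c) : ∀ᶠ x : ℝ in 𝓝 s, (deriv p x).re = 0 := by
  filter_upwards [h.eventually_nhds,
    continuous_ofReal.continuousAt.eventually hp.eventually_analyticAt] with x hx hxa
  have h1 : HasDerivAt (fun y : ℝ => (p y).re) (deriv p x).re x :=
    hxa.differentiableAt.hasDerivAt.real_of_complex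
  exact h1.unique ((hasDerivAt_const x c).congr_of_eventuallyEq hx)

theorem exists_analyticAt_sq_eq {q : ℂ → ℂ} {z : ℂ} (hq : AnalyticAt ℂ q z) (h0 : q z ≠ 0) :
    ∃ r : ℂ → ℂ, AnalyticAt ℂ r z ∧ ∀ w, r w ^ 2 = q w := by
  refine ⟨fun w => (q w / q z) ^ (2⁻¹ : ℂ) * (q z) ^ (2⁻¹ : ℂ), ?_, fun w => ?_⟩
  · refine AnalyticAt.mul (AnalyticAt.cpow (hq.div analyticAt_const h0) analyticAt_const ?_)
      analyticAt_const
    rw [div_self h0]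
    exact one_mem_slitPlane
  · have h2 : ∀ a : ℂ, (a ^ (2⁻¹ : ℂ)) ^ 2 = a := fun a => by
      have := Complex.cpow_nat_inv_pow a (two_ne_zero)
      exact_mod_cast this
    rw [mul_pow, h2, h2, div_mul_cancel₀ _ h0]

/-- An analytic function that is real and non-negative on the real axis has zeros of even order
there, hence has an analytic square root. -/
theorem exists_analyticAt_sq_eq_of_nonneg {q : ℂ → ℂ} {s : ℝ} (hq : AnalyticAt ℂ q s)
    (h : ∀ᶠ x : ℝ in 𝓝 s, (q x).im = 0 ∧ 0 ≤ (q x).re) :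
    ∃ r : ℂ → ℂ, AnalyticAt ℂ r s ∧ ∀ᶠ z in 𝓝 (s : ℂ), r z ^ 2 = q z := by
  by_cases hq0 : ∀ᶠ z in 𝓝 (s : ℂ), q z = 0
  · exact ⟨0, analyticAt_const, hq0.mono fun z hz => by simp [hz]⟩
  obtain ⟨n, k, hk, hk0, hqk⟩ := hq.exists_eventuallyEq_pow_smul_nonzero_iff.2 hq0
  obtain ⟨r, hr, hrk⟩ := exists_analyticAt_sq_eq hk hk0
  rcases Nat.even_or_odd n with ⟨m, rfl⟩ | hodd
  · refine ⟨fun z => (z - s) ^ m * r z, by fun_prop, ?_⟩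
    filter_upwards [hqk] with z hz
    rw [hz, mul_pow, hrk, smul_eq_mul]
    ring
  · exfalso
    -- for odd order the quotient `k` has opposite signs on the two sides of `s`
    have hkx : ∀ᶠ x : ℝ in 𝓝 s, x ≠ s →
        k x = (((x - s) ^ n)⁻¹ : ℝ) * ((q x).re : ℂ) := by
      filter_upwards [h, continuous_ofReal.continuousAt.eventually hqk] with x hx hx2 hne
      have hq' : q x = ((q x).re : ℂ) := Complex.ext (by simp) (by simp [hx.1])
      have hne' : ((x : ℂ) - s) ^ n ≠ 0 := pow_ne_zero _ (by
        rw [← ofReal_sub]; exact_mod_cast sub_ne_zero.2 hne)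
      rw [← hq', hx2, smul_eq_mul]
      push_cast
      rw [inv_mul_cancel_left₀ hne']
    have hct : Tendsto (fun x : ℝ => k x) (𝓝 s) (𝓝 (k s)) :=
      hk.continuousAt.tendsto.comp (continuous_ofReal.tendsto s)
    have him : (k s).im = 0 := by
      have h1 : Tendsto (fun x : ℝ => (k x).im) (𝓝[>] s) (𝓝 (k s).im) :=
        ((continuous_im.tendsto _).comp hct).mono_left nhdsWithin_le_nhds
      refine tendsto_nhds_unique h1 (tendsto_const_nhds.congr' ?_)
      filter_upwards [nhdsWithin_le_nhds hkx, self_mem_nhdsWithin] with x hx hxs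
      rw [hx (ne_of_gt hxs), ← ofReal_mul, ofReal_im]
    have hge : 0 ≤ (k s).re := by
      have h1 : Tendsto (fun x : ℝ => (k x).re) (𝓝[>] s) (𝓝 (k s).re) :=
        ((continuous_re.tendsto _).comp hct).mono_left nhdsWithin_le_nhds
      refine ge_of_tendsto h1 ?_
      filter_upwards [nhdsWithin_le_nhds hkx, nhdsWithin_le_nhds h, self_mem_nhdsWithin]
        with x hx hx0 hxs
      rw [hx (ne_of_gt hxs), ← ofReal_mul, ofReal_re]
      have : 0 < x - s := sub_pos.2 hxs
      exact mul_nonneg (by positivity) hx0.2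
    have hle : (k s).re ≤ 0 := by
      have h1 : Tendsto (fun x : ℝ => (k x).re) (𝓝[<] s) (𝓝 (k s).re) :=
        ((continuous_re.tendsto _).comp hct).mono_left nhdsWithin_le_nhds
      refine le_of_tendsto h1 ?_
      filter_upwards [nhdsWithin_le_nhds hkx, nhdsWithin_le_nhds h, self_mem_nhdsWithin]
        with x hx hx0 hxs
      rw [hx (ne_of_lt hxs), ← ofReal_mul, ofReal_re]
      have : x - s < 0 := sub_neg.2 hxs
      exact mul_nonpos_of_nonpos_of_nonneg (inv_nonpos.2 (hodd.pow_neg this).le) hx0.2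
    exact hk0 (Complex.ext (le_antisymm hle hge) him)

/-- If the square of the holomorphic derivative `φ` extends analytically across a real point with a
negative value there, then `φ` is imaginary on the real axis, so that the boundary values `v` of the
real part of its primitive are locally constant. -/
theorem eventually_const_of_sq_neg {h φ q : ℂ → ℂ} {v : ℂ → ℝ} {s : ℝ}
    (hh : ∀ z ∈ upperHalf, HasDerivAt h (φ z) z) (hφ : DifferentiableOn ℂ φ upperHalf)
    (hv : ContinuousOn v {x | 0 ≤ x.im}) (hvh : ∀ z ∈ upperHalf, v z = (h z).re)
    (hq : AnalyticAt ℂ q s) (hφq : ∀ᶠ z in 𝓝[upperHalf] (s : ℂ), φ z ^ 2 = q z)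
    (him : ∀ᶠ x : ℝ in 𝓝 s, (q x).im = 0) (hneg : (q s).re < 0) :
    ∃ c, ∀ᶠ x : ℝ in 𝓝 s, v x = c := by
  set r : ℂ → ℂ := fun z => I * (-q z) ^ (2⁻¹ : ℂ) with hr
  have hra : AnalyticAt ℂ r s :=
    analyticAt_const.mul (hq.neg.cpow analyticAt_const (Or.inl (by simpa using hneg)))
  have hr2 : ∀ z, r z ^ 2 = q z := fun z => by
    have : ((-q z) ^ (2⁻¹ : ℂ)) ^ 2 = -q z := by
      exact_mod_cast Complex.cpow_nat_inv_pow (-q z) (two_ne_zero)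
    rw [hr, mul_pow, this, I_sq]; ring
  have hrre : ∀ᶠ x : ℝ in 𝓝 s, (r x).re = 0 := by
    have hc : ContinuousAt (fun x : ℝ => (q x).re) s :=
      continuous_re.continuousAt.comp (hq.continuousAt.comp continuous_ofReal.continuousAt)
    filter_upwards [him, hc.eventually_lt_const hneg] with x hx hx2
    have : -q x = ((-(q x).re : ℝ) : ℂ) := Complex.ext (by simp) (by simp [hx])
    rw [hr]
    simp only
    rw [this, show (2⁻¹ : ℂ) = ((2⁻¹ : ℝ) : ℂ) by push_cast; rfl,
      ← ofReal_cpow (by linarith), I_mul_re, ofReal_im, neg_zero]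
  obtain ⟨σ, hσa, hσ, hσre⟩ : ∃ σ : ℂ → ℂ, AnalyticAt ℂ σ s ∧
      (∀ᶠ z in 𝓝[upperHalf] (s : ℂ), φ z = σ z) ∧ ∀ᶠ x : ℝ in 𝓝 s, (σ x).re = 0 := by
    rcases eventually_eq_or_eq_neg_of_upperHalf hφ hra (by
      filter_upwards [hφq] with z hz
      rw [← hr2 z] at hz
      exact sq_eq_sq_iff_eq_or_eq_neg.1 hz) with h1 | h1
    · exact ⟨r, hra, h1, hrre⟩
    · exact ⟨-r, hra.neg, h1, by filter_upwards [hrre] with x hx; simp [hx]⟩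
  obtain ⟨R, hR, hball⟩ := Metric.eventually_nhds_iff_ball.1
    (hσa.eventually_analyticAt.and (eventually_nhdsWithin_iff.1 hσ))
  obtain ⟨ρ, hρ⟩ := DifferentiableOn.isExactOn_ball (c := (s : ℂ)) (r := R) (f := σ)
    fun z hz => (hball z hz).1.differentiableAt.differentiableWithinAt
  have hρa : AnalyticAt ℂ ρ s := DifferentiableOn.analyticAt (s := ball (s : ℂ) R)
    (fun z hz => (hρ z hz).differentiableAt.differentiableWithinAt) (ball_mem_nhds _ hR)
  have hder : ∀ z ∈ ball (s : ℂ) R ∩ upperHalf, HasDerivAt (fun z => h z - ρ z) 0 z :=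
    fun z hz => by
      have := (hh z hz.2).sub (hρ z hz.1)
      rwa [(hball z hz.1).2 hz.2, sub_self] at this
  obtain ⟨d, hd⟩ := (isOpen_ball.inter isOpen_upperHalf).exists_is_const_of_deriv_eq_zero
    ((convex_ball (s : ℂ) R).inter convex_upperHalf).isPreconnected
    (fun z hz => (hder z hz).differentiableAt.differentiableWithinAt)
    (fun z hz => (hder z hz).deriv)
  have hval := eventually_real_eq_re hv (hρa.add (analyticAt_const (v := d))) (by
    filter_upwards [nhdsWithin_le_nhds (ball_mem_nhds (s : ℂ) hR), self_mem_nhdsWithin]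
      with z hz hzu
    rw [hvh z hzu, ← hd z ⟨hz, hzu⟩]
    simp)
  -- the boundary values have derivative zero on a real interval
  obtain ⟨e, he, hI⟩ := Metric.eventually_nhds_iff_ball.1 (hval.and (hσre.and
    (continuous_ofReal.continuousAt.eventually (ball_mem_nhds (s : ℂ) hR))))
  have hder' : ∀ x ∈ ball s e, HasDerivAt (fun y : ℝ => (ρ y).re) 0 x := fun x hx => by
    have := (hρ x (hI x hx).2.2).real_of_complex
    rwa [(hI x hx).2.1] at this
  obtain ⟨c, hc⟩ := isOpen_ball.exists_is_const_of_deriv_eq_zero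
    (convex_ball s e).isPreconnected
    (fun x hx => (hder' x hx).differentiableAt.differentiableWithinAt)
    (fun x hx => (hder' x hx).deriv)
  refine ⟨c + d.re, ?_⟩
  filter_upwards [ball_mem_nhds s he] with x hx
  rw [(hI x hx).1, ← hc x hx]
  simp

/-! ### Pre-images of half-turns and of their products -/

/-- The pre-image `diag (1, -1) ũ` in `SU⁻(1,1)` of the half-turn about the direction of `u`; the
other pre-image is its negative. -/
def edgeMat (u : L3) : Matrix (Fin 2) (Fin 2) ℂ :=
  !![(u 2 : ℂ), (u 1 : ℂ) + Complex.I * u 0; -((u 1 : ℂ) - Complex.I * u 0), -(u 2 : ℂ)]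

/-- `D` is one of the two pre-images of the half-turn about the direction of `u`. -/
def IsEdgeMat (u : L3) (D : Matrix (Fin 2) (Fin 2) ℂ) : Prop := D = edgeMat u ∨ D = -edgeMat u

theorem lor_self_ofReal {u : L3} (hu : lor u u = 1) :
    (u 0 : ℂ) ^ 2 + (u 1 : ℂ) ^ 2 - (u 2 : ℂ) ^ 2 = 1 := by
  have : u 0 ^ 2 + u 1 ^ 2 - u 2 ^ 2 = 1 := by rw [← hu, lor]; ring
  exact_mod_cast this

theorem edgeMat_mul_self {u : L3} (hu : lor u u = 1) : edgeMat u * edgeMat u = -1 := by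
  have h := lor_self_ofReal hu
  ext i j
  fin_cases i <;> fin_cases j <;> simp [edgeMat, Matrix.mul_apply, Fin.sum_univ_two]
  · linear_combination -h + (u 0 : ℂ) ^ 2 * I_sq
  · ring
  · ring
  · linear_combination -h + (u 0 : ℂ) ^ 2 * I_sq

theorem IsEdgeMat.inv_eq {u : L3} {D : Matrix (Fin 2) (Fin 2) ℂ} (hu : lor u u = 1)
    (hD : IsEdgeMat u D) : D⁻¹ = -D := by
  refine Matrix.inv_eq_right_inv ?_
  rcases hD with rfl | rfl <;> simp [edgeMat_mul_self hu]

theorem IsEdgeMat.inv_mul {u : L3} {D : Matrix (Fin 2) (Fin 2) ℂ} (hu : lor u u = 1)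
    (hD : IsEdgeMat u D) : D⁻¹ * D = 1 := by
  rw [hD.inv_eq hu]
  rcases hD with rfl | rfl <;> simp [edgeMat_mul_self hu]

theorem IsEdgeMat.det_eq_one {u : L3} {D : Matrix (Fin 2) (Fin 2) ℂ} (hu : lor u u = 1)
    (hD : IsEdgeMat u D) : D.det = 1 := by
  have h := lor_self_ofReal hu
  have h1 : (edgeMat u).det = 1 := by
    rw [edgeMat, Matrix.det_fin_two_of]
    linear_combination h - (u 0 : ℂ) ^ 2 * I_sq
  rcases hD with rfl | rfl
  · exact h1
  · rw [Matrix.det_neg, h1]; simp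

/-- Elements of `SU⁻(1,1)` reverse the sign of the Hermitian form. -/
theorem IsEdgeMat.conjTranspose_mul_mul {u : L3} {D : Matrix (Fin 2) (Fin 2) ℂ}
    (hu : lor u u = 1) (hD : IsEdgeMat u D) :
    Dᴴ * !![1, 0; 0, -1] * D = -!![1, 0; 0, -1] := by
  have h := lor_self_ofReal hu
  have h1 : (edgeMat u)ᴴ * !![1, 0; 0, -1] * edgeMat u = -!![1, 0; 0, -1] := by
    ext i j
    fin_cases i <;> fin_cases j <;>
      simp [edgeMat, Matrix.mul_apply, Fin.sum_univ_two]
    · linear_combination -h + (u 0 : ℂ) ^ 2 * I_sq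
    · ring
    · ring
    · linear_combination h - (u 0 : ℂ) ^ 2 * I_sq
  rcases hD with rfl | rfl
  · exact h1
  · simpa using h1

theorem matJ_mul_self : matJ * matJ = -1 := by
  ext i j
  fin_cases i <;> fin_cases j <;> simp [matJ]

theorem IsEdgeMat.mem_SU11minus {u : L3} {D : Matrix (Fin 2) (Fin 2) ℂ} (hu : lor u u = 1)
    (hD : IsEdgeMat u D) : D ∈ SU11minus := by
  refine ⟨-(D * matJ), ⟨?_, ?_⟩, ?_⟩
  · rw [Matrix.det_neg, Matrix.det_mul, hD.det_eq_one hu]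
    simp [matJ]
  · have hJ : matJᴴ * (-!![1, 0; 0, -1]) * matJ = !![1, 0; 0, -1] := by
      ext i j
      fin_cases i <;> fin_cases j <;> simp [matJ, Matrix.mul_apply, Fin.sum_univ_two]
    calc (-(D * matJ))ᴴ * !![1, 0; 0, -1] * -(D * matJ)
        = matJᴴ * (Dᴴ * !![1, 0; 0, -1] * D) * matJ := by
          simp only [Matrix.mul_neg, Matrix.conjTranspose_neg, Matrix.conjTranspose_mul,
            Matrix.neg_mul, neg_neg, Matrix.mul_assoc]
      _ = !![1, 0; 0, -1] := by rw [hD.conjTranspose_mul_mul hu, hJ]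
  · rw [neg_mul, Matrix.mul_assoc, matJ_mul_self]; simp

theorem IsEdgeMat.isSpinImageMinus {u : L3} {D : Matrix (Fin 2) (Fin 2) ℂ} (hu : lor u u = 1)
    (hD : IsEdgeMat u D) : IsSpinImageMinus D (halfTurn u) := by
  intro v
  have h := lor_self_ofReal hu
  have h1 : hermMat (halfTurn u v) = -((edgeMat u)ᴴ * hermMat v * edgeMat u) := by
    ext i j
    fin_cases i <;> fin_cases j <;>
      simp [edgeMat, hermMat, halfTurn, lor, Matrix.mul_apply, Fin.sum_univ_two]
    all_goals ring_nf
    all_goals simp only [I_sq, I_pow_three]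
    all_goals ring_nf
    · linear_combination (v 2 : ℂ) * h
    · linear_combination ((v 1 : ℂ) + I * v 0) * h
    · linear_combination ((v 1 : ℂ) - I * v 0) * h
    · linear_combination (v 2 : ℂ) * h
  rcases hD with rfl | rfl
  · exact h1
  · simpa using h1

theorem mul_inv_mem_SU11 {u u' : L3} {D D' : Matrix (Fin 2) (Fin 2) ℂ} (hu : lor u u = 1)
    (hu' : lor u' u' = 1) (hD : IsEdgeMat u D) (hD' : IsEdgeMat u' D') : D * D'⁻¹ ∈ SU11 := by
  rw [hD'.inv_eq hu']
  refine ⟨by simp [Matrix.det_neg, hD.det_eq_one hu, hD'.det_eq_one hu'], ?_⟩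
  have h1 := hD.conjTranspose_mul_mul hu
  have h2 := hD'.conjTranspose_mul_mul hu'
  calc (D * -D')ᴴ * !![1, 0; 0, -1] * (D * -D')
      = D'ᴴ * (Dᴴ * !![1, 0; 0, -1] * D) * D' := by
        simp only [Matrix.mul_neg, Matrix.conjTranspose_neg, Matrix.conjTranspose_mul,
          Matrix.neg_mul, neg_neg, Matrix.mul_assoc]
    _ = !![1, 0; 0, -1] := by rw [h1, Matrix.mul_neg, Matrix.neg_mul, h2, neg_neg]

/-- The matrix of the half-turn about the direction of `u`. -/
def halfTurnMat (u : L3) : Matrix (Fin 3) (Fin 3) ℝ :=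
  !![2 * u 0 * u 0 - 1, 2 * u 1 * u 0, -(2 * u 2 * u 0);
    2 * u 0 * u 1, 2 * u 1 * u 1 - 1, -(2 * u 2 * u 1);
    2 * u 0 * u 2, 2 * u 1 * u 2, -(2 * u 2 * u 2) - 1]

theorem halfTurnMat_mulVec (u v : L3) : halfTurnMat u *ᵥ v = halfTurn u v := by
  ext i
  fin_cases i <;> simp [halfTurnMat, halfTurn, lor, Matrix.mulVec, dotProduct,
    Fin.sum_univ_three] <;> ring

theorem halfTurnMat_mul_diagonal_mul_transpose {u : L3} (hu : lor u u = 1) :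
    halfTurnMat u * Matrix.diagonal ![1, 1, -1] * (halfTurnMat u)ᵀ =
      Matrix.diagonal ![1, 1, -1] := by
  have h : u 2 ^ 2 = u 0 ^ 2 + u 1 ^ 2 - 1 := by rw [← hu, lor]; ring
  have hd : Matrix.diagonal ![1, 1, -1] = (!![1, 0, 0; 0, 1, 0; 0, 0, -1] :
      Matrix (Fin 3) (Fin 3) ℝ) := by
    ext i j
    fin_cases i <;> fin_cases j <;> simp
  rw [hd]
  ext i j
  fin_cases i <;> fin_cases j <;> simp [halfTurnMat, Matrix.mul_apply, Fin.sum_univ_three]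
  · linear_combination (-4 * u 0 ^ 2) * h
  · linear_combination (-4 * u 0 * u 1) * h
  · linear_combination (-4 * u 0 * u 2) * h
  · linear_combination (-4 * u 0 * u 1) * h
  · linear_combination (-4 * u 1 ^ 2) * h
  · linear_combination (-4 * u 1 * u 2) * h
  · linear_combination (-4 * u 0 * u 2) * h
  · linear_combination (-4 * u 1 * u 2) * h
  · linear_combination (-4 * u 2 ^ 2) * h

theorem halfTurnMat_mul_self {u : L3} (hu : lor u u = 1) : halfTurnMat u * halfTurnMat u = 1 := by
  have h : u 2 ^ 2 = u 0 ^ 2 + u 1 ^ 2 - 1 := by rw [← hu, lor]; ring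
  ext i j
  fin_cases i <;> fin_cases j <;> simp [halfTurnMat, Matrix.mul_apply, Fin.sum_univ_three]
  · linear_combination (-4 * u 0 ^ 2) * h
  · linear_combination (-4 * u 0 * u 1) * h
  · linear_combination (4 * u 0 * u 2) * h
  · linear_combination (-4 * u 0 * u 1) * h
  · linear_combination (-4 * u 1 ^ 2) * h
  · linear_combination (4 * u 1 * u 2) * h
  · linear_combination (-4 * u 0 * u 2) * h
  · linear_combination (-4 * u 1 * u 2) * h
  · linear_combination (4 * u 2 ^ 2) * h

theorem det_halfTurnMat {u : L3} (hu : lor u u = 1) : (halfTurnMat u).det = 1 := by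
  have h : u 2 ^ 2 = u 0 ^ 2 + u 1 ^ 2 - 1 := by rw [← hu, lor]; ring
  simp [halfTurnMat, Matrix.det_fin_three]
  linear_combination (-2) * h

/-- The product of the pre-images of two half-turns lies over the product of the half-turns. -/
theorem isSpinImage_mul_inv {u u' : L3} {D D' : Matrix (Fin 2) (Fin 2) ℂ} (hu : lor u u = 1)
    (hu' : lor u' u' = 1) (hD : IsEdgeMat u D) (hD' : IsEdgeMat u' D') :
    IsSpinImage (D * D'⁻¹) (fun v => (halfTurnMat u' * halfTurnMat u) *ᵥ v) := by
  intro v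
  simp only
  rw [← Matrix.mulVec_mulVec, halfTurnMat_mulVec, halfTurnMat_mulVec,
    hD'.isSpinImageMinus hu', hD.isSpinImageMinus hu, hD'.inv_eq hu']
  simp only [Matrix.mul_neg, Matrix.conjTranspose_neg, Matrix.conjTranspose_mul,
    Matrix.neg_mul, neg_neg, Matrix.mul_assoc]

theorem adjugate_halfTurnMat {u : L3} (hu : lor u u = 1) :
    (halfTurnMat u).adjugate = halfTurnMat u := by
  calc (halfTurnMat u).adjugate
      = (halfTurnMat u).adjugate * (halfTurnMat u * halfTurnMat u) := by
        rw [halfTurnMat_mul_self hu, mul_one]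
    _ = halfTurnMat u := by
        rw [← mul_assoc, Matrix.adjugate_mul, det_halfTurnMat hu, one_smul, one_mul]

theorem charpoly_fin_three {R : Type*} [CommRing R] (A : Matrix (Fin 3) (Fin 3) R) :
    A.charpoly = Polynomial.X ^ 3 - Polynomial.C (A 0 0 + A 1 1 + A 2 2) * Polynomial.X ^ 2 +
      Polynomial.C (A 0 0 * A 1 1 - A 0 1 * A 1 0 + A 0 0 * A 2 2 - A 0 2 * A 2 0 +
        A 1 1 * A 2 2 - A 1 2 * A 2 1) * Polynomial.X - Polynomial.C A.det := by
  simp [Matrix.charpoly, Matrix.det_fin_three]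
  ring

theorem lor_cross_self (a b : L3) :
    lor (cross a b) (cross a b) = lor a b ^ 2 - lor a a * lor b b := by
  simp [lor, cross]; ring

theorem isTimelikeRotation_halfTurnMat_mul {u u' : L3} (hu : lor u u = 1) (hu' : lor u' u' = 1)
    (hneg : lor (cross u' u) (cross u' u) < 0) :
    IsTimelikeRotation (halfTurnMat u' * halfTurnMat u)
      ((Real.sqrt (-lor (cross u' u) (cross u' u)))⁻¹ • (-cross u' u))
      (2 * Real.pi * (Real.arccos (lor u' u) / Real.pi)) := by
  set c := lor u' u with hc
  have hc1 : c ^ 2 < 1 := by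
    have := lor_cross_self u' u
    rw [hu, hu', ← hc] at this
    linarith
  have hcabs := abs_lt.1 ((sq_lt_one_iff_abs_lt_one c).1 hc1)
  have h : u 2 ^ 2 = u 0 ^ 2 + u 1 ^ 2 - 1 := by rw [← hu, lor]; ring
  have h' : u' 2 ^ 2 = u' 0 ^ 2 + u' 1 ^ 2 - 1 := by rw [← hu', lor]; ring
  have hc' : c = u' 0 * u 0 + u' 1 * u 1 - u' 2 * u 2 := rfl
  refine ⟨⟨?_, ?_, ?_⟩, ?_, ?_, ?_⟩
  · have h1 := halfTurnMat_mul_diagonal_mul_transpose hu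
    have h2 := halfTurnMat_mul_diagonal_mul_transpose hu'
    rw [Matrix.transpose_mul]
    calc _ = halfTurnMat u' * (halfTurnMat u * Matrix.diagonal ![1, 1, -1] *
          (halfTurnMat u)ᵀ) * (halfTurnMat u')ᵀ := by simp only [Matrix.mul_assoc]
      _ = _ := by rw [h1, h2]
  · rw [Matrix.det_mul, det_halfTurnMat hu, det_halfTurnMat hu', one_mul]
  · have : (halfTurnMat u' * halfTurnMat u) 2 2 =
        2 * u 2 ^ 2 + 2 * u' 2 ^ 2 - 4 * c * (u 2 * u' 2) + 1 := by
      rw [hc']; simp [halfTurnMat, Matrix.mul_apply, Fin.sum_univ_three]; ring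
    rw [this]
    nlinarith [mul_nonneg (by linarith : 0 ≤ 1 - c) (sq_nonneg (u 2 + u' 2)),
      mul_nonneg (by linarith : 0 ≤ 1 + c) (sq_nonneg (u 2 - u' 2))]
  · have hs : ∀ (k : ℝ) (w : L3), lor (k • w) (k • w) = k ^ 2 * lor w w := fun k w => by
      simp [lor]; ring
    have hn : lor (-cross u' u) (-cross u' u) = lor (cross u' u) (cross u' u) := by
      simp [lor]
    rw [hs, hn]
    have := inv_pos.2 (Real.sqrt_pos.2 (neg_pos.2 hneg))
    exact mul_neg_of_pos_of_neg (by positivity) hneg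
  · have h1 : halfTurn u (cross u' u) = -cross u' u := by
      have : lor (cross u' u) u = 0 := by simp [lor, cross]; ring
      rw [halfTurn, this]; simp
    have h2 : halfTurn u' (-cross u' u) = cross u' u := by
      have : lor (-cross u' u) u' = 0 := by simp [lor, cross]; ring
      rw [halfTurn, this]; simp
    have h3 : (halfTurnMat u' * halfTurnMat u) *ᵥ cross u' u = cross u' u := by
      rw [← Matrix.mulVec_mulVec, halfTurnMat_mulVec, halfTurnMat_mulVec, h1, h2]
    rw [Matrix.mulVec_smul, Matrix.mulVec_neg, h3]
  · have hφ : 2 * Real.pi * (Real.arccos c / Real.pi) = 2 * Real.arccos c := by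
      field_simp
    rw [hφ]
    set e := Complex.exp (((2 * Real.arccos c : ℝ) : ℂ) * I) with he
    set e' := Complex.exp (-(((2 * Real.arccos c : ℝ) : ℂ) * I)) with he'
    have hmul : e * e' = 1 := by rw [he, he', ← Complex.exp_add]; simp
    have hadd : e + e' = 4 * (c : ℂ) ^ 2 - 2 := by
      have h1 : e + e' = 2 * Complex.cos ((2 * Real.arccos c : ℝ) : ℂ) := by
        rw [Complex.cos, he, he', neg_mul]; ring
      rw [h1, ← Complex.ofReal_cos, Real.cos_two_mul, Real.cos_arccos hcabs.1.le hcabs.2.le]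
      push_cast; ring
    set R := halfTurnMat u' * halfTurnMat u with hR
    have htr : R 0 0 + R 1 1 + R 2 2 = 4 * c ^ 2 - 1 := by
      rw [hR, hc']; simp [halfTurnMat, Matrix.mul_apply, Fin.sum_univ_three]
      linear_combination 2 * h + 2 * h'
    have hmin : R 0 0 * R 1 1 - R 0 1 * R 1 0 + R 0 0 * R 2 2 - R 0 2 * R 2 0 +
        R 1 1 * R 2 2 - R 1 2 * R 2 1 = 4 * c ^ 2 - 1 := by
      -- the sum of the principal minors is the trace of the adjugate
      have h1 : R.adjugate.trace = R.trace := by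
        rw [hR, Matrix.adjugate_mul_distrib, adjugate_halfTurnMat hu, adjugate_halfTurnMat hu',
          Matrix.trace_mul_comm]
      rw [Matrix.trace_fin_three, Matrix.trace_fin_three, htr, Matrix.adjugate_fin_three] at h1
      simp at h1
      linear_combination h1
    have hdet : R.det = 1 := by rw [hR, Matrix.det_mul, det_halfTurnMat hu, det_halfTurnMat hu',
      one_mul]
    have hdet' : (R.map Complex.ofReal).det = 1 := by
      have h1 : (R.map Complex.ofReal).det = ((R.det : ℝ) : ℂ) :=
        (RingHom.map_det Complex.ofRealHom R).symm
      rw [h1, hdet, ofReal_one]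
    rw [charpoly_fin_three, hdet']
    simp only [Matrix.map_apply]
    rw [show (R 0 0 : ℂ) + R 1 1 + R 2 2 = 1 + (e + e') by
        rw [hadd]; norm_cast; rw [htr]; ring,
      show (R 0 0 : ℂ) * R 1 1 - R 0 1 * R 1 0 + R 0 0 * R 2 2 - R 0 2 * R 2 0 +
        R 1 1 * R 2 2 - R 1 2 * R 2 1 = (e + e') + e * e' by
        rw [hadd, hmul]; norm_cast; rw [hmin]; ring]
    rw [show (1 : ℂ) = e * e' from hmul.symm]
    have hC : Polynomial.C e * Polynomial.C e' = (1 : Polynomial ℂ) := by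
      rw [← Polynomial.C_mul, hmul, Polynomial.C_1]
    simp only [Polynomial.C_add, Polynomial.C_mul, hC]
    linear_combination (1 - Polynomial.X) * hC

/-! ### Reflection of the Weierstrass data -/

/-- Two vectors in `ℂ²` with the same symmetric square agree up to sign. -/
theorem eq_or_eq_neg_of_sq_eq {a b g h : ℂ} (h1 : a ^ 2 = g ^ 2) (h2 : b ^ 2 = h ^ 2)
    (h3 : a * b = g * h) : ![g, h] = ![a, b] ∨ ![g, h] = -![a, b] := by
  rcases sq_eq_sq_iff_eq_or_eq_neg.1 h1 with rfl | rfl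
  · rcases eq_or_ne a 0 with rfl | ha
    · rcases sq_eq_sq_iff_eq_or_eq_neg.1 h2 with rfl | rfl <;> simp
    · left; rw [mul_left_cancel₀ ha h3]
  · rcases eq_or_ne g 0 with rfl | ha
    · rcases sq_eq_sq_iff_eq_or_eq_neg.1 h2 with rfl | rfl <;> simp
    · right
      have : h = -b := mul_left_cancel₀ ha (by linear_combination -h3)
      simp [this]

/-- If the half-turn about `u` maps the value `p` of the Weierstrass integrand to its conjugate,
then the row vector `(g, h)` is, up to sign, obtained from its conjugate by `J D⁻¹`. -/
theorem eq_conj_vecMul_or_eq_neg {u : L3} {D : Matrix (Fin 2) (Fin 2) ℂ} (hu : lor u u = 1)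
    (hD : IsEdgeMat u D) {g h : ℂ} {p : Fin 3 → ℂ} {ρ : ℝ}
    (hg : g ^ 2 = -(p 0 + I * p 1) / 2) (hh : h ^ 2 = (p 0 - I * p 1) / 2)
    (hgh : g * h = -I * p 2 / 2) (hρ : (ρ : ℂ) = u 0 * p 0 + u 1 * p 1 - u 2 * p 2)
    (hp : ∀ k, (starRingEnd ℂ) (p k) = 2 * ρ * u k - p k) :
    ![g, h] = ![(starRingEnd ℂ) g, (starRingEnd ℂ) h] ᵥ* (matJ * D⁻¹) ∨
      ![g, h] = -(![(starRingEnd ℂ) g, (starRingEnd ℂ) h] ᵥ* (matJ * D⁻¹)) := by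
  have hE := lor_self_ofReal hu
  have cg := congrArg (starRingEnd ℂ) hg
  have ch := congrArg (starRingEnd ℂ) hh
  have cgh := congrArg (starRingEnd ℂ) hgh
  simp only [map_pow, map_mul, map_div₀, map_neg, map_add, map_sub, hp, conj_I, map_ofNat]
    at cg ch cgh
  set g' := (starRingEnd ℂ) g
  set h' := (starRingEnd ℂ) h
  set a : ℂ := -I * (-g' * (u 1 - I * u 0) + h' * u 2) with ha
  set b : ℂ := -I * (-g' * u 2 + h' * (u 1 + I * u 0)) with hb
  have hvec : ![g', h'] ᵥ* (matJ * -edgeMat u) = ![a, b] := by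
    ext i
    fin_cases i <;>
      simp [Matrix.vecMul, dotProduct, Matrix.mul_apply, Fin.sum_univ_two, matJ, edgeMat, ha, hb]
      <;> ring
  -- after conjugation by `hp`, the differences of the quadratic monomials are multiples of `hE`
  have key : ![g, h] = ![a, b] ∨ ![g, h] = -![a, b] := by
    refine eq_or_eq_neg_of_sq_eq ?_ ?_ ?_
    · rw [ha]
      linear_combination (norm := skip) (-1) * (u 1 - I * u 0) ^ 2 * cg +
        2 * (u 1 - I * u 0) * u 2 * cgh - (u 2 : ℂ) ^ 2 * ch - hg -
        ((p 0 + I * p 1) / 2 + I * ρ * (u 1 - I * u 0)) * hE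
      rw [hρ]
      ring_nf
      simp only [I_sq, I_pow_three, I_pow_four]
      ring
    · rw [hb]
      linear_combination (norm := skip) (-1) * (u 2 : ℂ) ^ 2 * cg +
        2 * (u 1 + I * u 0) * u 2 * cgh - (u 1 + I * u 0) ^ 2 * ch - hh +
        ((p 0 - I * p 1) / 2 - I * ρ * (u 1 + I * u 0)) * hE
      rw [hρ]
      ring_nf
      simp only [I_sq, I_pow_three, I_pow_four]
      ring
    · rw [ha, hb]
      linear_combination (norm := skip) (-1) * (u 1 - I * u 0) * u 2 * cg +
        ((u 1 - I * u 0) * (u 1 + I * u 0) + (u 2 : ℂ) ^ 2) * cgh -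
        (u 1 + I * u 0) * u 2 * ch - hgh - I * (ρ * u 2 + p 2 / 2) * hE
      rw [hρ]
      ring_nf
      simp only [I_sq, I_pow_three, I_pow_four]
      ring
  rw [hD.inv_eq hu]
  rcases hD with rfl | rfl
  · rwa [hvec]
  · have : ![g', h'] ᵥ* (matJ * - -edgeMat u) = -![a, b] := by
      rw [← hvec, neg_neg, Matrix.mul_neg, Matrix.vecMul_neg, neg_neg]
    rw [this, neg_neg]
    exact key.symm

/-! ### Continuation of the Weierstrass data across an edge -/

/-- The row vector in the lower half-plane obtained from `(G, H)` by the reflection across an edge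
whose half-turn has the pre-image `D`. -/
def reflectedRow (G H : ℂ → ℂ) (D : Matrix (Fin 2) (Fin 2) ℂ) (z : ℂ) : Fin 2 → ℂ :=
  ![(starRingEnd ℂ) (G ((starRingEnd ℂ) z)), (starRingEnd ℂ) (H ((starRingEnd ℂ) z))] ᵥ*
    (matJ * D⁻¹)

/-- Near the real point `s`, the row vector `(G, H)` extends analytically to the lower half-plane,
where the extension is `reflectedRow G H D`. -/
def ExtendsAcross (G H : ℂ → ℂ) (D : Matrix (Fin 2) (Fin 2) ℂ) (s : ℝ) : Prop :=
  ∃ g : ℂ → Fin 2 → ℂ, AnalyticAt ℂ g s ∧ ∀ᶠ z in 𝓝 (s : ℂ),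
    (0 < z.im → g z = ![G z, H z]) ∧ (z.im < 0 → g z = reflectedRow G H D z)

theorem dX_eq_of_hasDerivAt {F : ℂ → Fin 3 → ℂ} {X : ℂ → L3} {W : ℂ → Fin 3 → ℂ}
    (hF : ∀ x ∈ upperHalf, HasDerivAt F (W x) x)
    (hX : ∀ x ∈ upperHalf, ∀ k, X x k = (F x k).re) {z : ℂ} (hz : z ∈ upperHalf) (k : Fin 3) :
    dX X z k = W z k / 2 := by
  have hev : X =ᶠ[𝓝 z] fun w k => (F w k).re := by
    filter_upwards [isOpen_upperHalf.mem_nhds hz] with w hw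
    exact funext fun k => hX w hw k
  have h1 : HasFDerivAt (fun w k => (F w k).re) (ContinuousLinearMap.pi fun k =>
      reCLM.comp ((ContinuousLinearMap.toSpanSingleton ℂ (W z k)).restrictScalars ℝ)) z :=
    hasFDerivAt_pi.2 fun k => reCLM.hasFDerivAt.comp z
      ((hasDerivAt_pi.1 (hF z hz) k).hasFDerivAt.restrictScalars ℝ)
  rw [dX, (h1.congr_of_eventuallyEq hev).fderiv]
  refine congrArg (· / 2) (Complex.ext ?_ ?_) <;> simp

/-- A holomorphic function whose real part has boundary values constant near `s` has a derivative
that extends analytically across `s`, with imaginary values on the real axis. -/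
theorem exists_analyticAt_deriv_of_re_eq_const {f w : ℂ → ℂ} {v : ℂ → ℝ} {s c : ℝ}
    (hf : ∀ z ∈ upperHalf, HasDerivAt f (w z) z) (hv : ContinuousOn v {x | 0 ≤ x.im})
    (hfv : ∀ z ∈ upperHalf, v z = (f z).re) (hc : ∀ᶠ x : ℝ in 𝓝 s, v x = c) :
    ∃ N : ℂ → ℂ, AnalyticAt ℂ N s ∧ (∀ᶠ z in 𝓝[upperHalf] (s : ℂ), w z = N z) ∧
      ∀ᶠ x : ℝ in 𝓝 s, (N x).re = 0 := by
  obtain ⟨p, hp, hpf⟩ := exists_analyticAt_of_re_eq_const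
    (fun z hz => (hf z hz).differentiableAt.differentiableWithinAt) hv hfv hc
  refine ⟨deriv p, hp.deriv, ?_, eventually_re_deriv_eq_zero (c := c) hp ?_⟩
  · have h1 := eventually_eventually_nhds.2 (eventually_nhdsWithin_iff.1 hpf)
    filter_upwards [nhdsWithin_le_nhds h1, self_mem_nhdsWithin] with z hz hzu
    have : p =ᶠ[𝓝 z] f := by
      filter_upwards [hz, isOpen_upperHalf.mem_nhds hzu] with y hy hyu using hy hyu
    rw [this.deriv_eq, (hf z hzu).deriv]
  · have := eventually_real_eq_re hv hp (by
      filter_upwards [hpf, self_mem_nhdsWithin] with z hz hzu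
      rw [hz, hfv z hzu])
    filter_upwards [this, hc] with x h1 h2
    rw [← h1, h2]

/-- If `G²` and `G H` extend analytically across `s` and the extension of `G²` does not vanish
there, then `G` and `H` extend: `G` is a branch of a square root, and `H = G H / G`. -/
theorem exists_analyticAt_pair {G H A C : ℂ → ℂ} {s : ℝ} (hG : DifferentiableOn ℂ G upperHalf)
    (hA : AnalyticAt ℂ A s) (hC : AnalyticAt ℂ C s) (hA0 : A s ≠ 0)
    (hGA : ∀ᶠ z in 𝓝[upperHalf] (s : ℂ), G z ^ 2 = A z)
    (hGC : ∀ᶠ z in 𝓝[upperHalf] (s : ℂ), G z * H z = C z) :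
    ∃ g h : ℂ → ℂ, AnalyticAt ℂ g s ∧ AnalyticAt ℂ h s ∧
      (∀ᶠ z in 𝓝[upperHalf] (s : ℂ), G z = g z) ∧ ∀ᶠ z in 𝓝[upperHalf] (s : ℂ), H z = h z := by
  obtain ⟨r, hr, hrA⟩ := exists_analyticAt_sq_eq hA hA0
  obtain ⟨g, hg, hg0, hGg⟩ : ∃ g : ℂ → ℂ, AnalyticAt ℂ g s ∧ g s ≠ 0 ∧
      ∀ᶠ z in 𝓝[upperHalf] (s : ℂ), G z = g z := by
    have hr0 : r s ≠ 0 := fun h => hA0 (by rw [← hrA, h]; simp)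
    rcases eventually_eq_or_eq_neg_of_upperHalf hG hr (by
      filter_upwards [hGA] with z hz
      rw [← hrA z] at hz
      exact sq_eq_sq_iff_eq_or_eq_neg.1 hz) with h1 | h1
    · exact ⟨r, hr, hr0, h1⟩
    · exact ⟨-r, hr.neg, by simpa using hr0, h1⟩
  refine ⟨g, fun z => C z / g z, hg, hC.div hg hg0, hGg, ?_⟩
  filter_upwards [hGg, hGC, nhdsWithin_le_nhds (hg.continuousAt.eventually_ne hg0)]
    with z h1 h2 h3
  rw [eq_div_iff h3, ← h2, h1, mul_comm]

theorem analyticAt_conj_conj {f : ℂ → ℂ} {s : ℝ} (hf : AnalyticAt ℂ f s) :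
    AnalyticAt ℂ (fun z => (starRingEnd ℂ) (f ((starRingEnd ℂ) z))) s := by
  rw [analyticAt_iff_eventually_differentiableAt] at hf ⊢
  have hc : Tendsto (starRingEnd ℂ) (𝓝 (s : ℂ)) (𝓝 (s : ℂ)) := by
    have := continuous_conj.tendsto (s : ℂ)
    rwa [conj_ofReal] at this
  filter_upwards [hc.eventually hf] with z hz
  exact differentiableAt_conj_conj_iff.2 hz

/-- Near an edge, the Weierstrass integrand extends analytically, without zero on the edge, and the
half-turn about the edge maps its boundary values to their conjugates. -/
theorem exists_analyticAt_weierstrassForm {X : ℂ → L3} {G H : ℂ → ℂ} {u c : L3} {l : ℝ → ℝ}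
    {S : Set ℝ} {s : ℝ} (hu : lor u u = 1) (hXc : ContinuousOn X {x | 0 ≤ x.im})
    (hGH : IsWeierstrassData G H X) (hS : S ∈ 𝓝 s) (hl : StrictMonoOn l S)
    (hX : ∀ x ∈ S, X (x : ℂ) = c + l x • u)
    (hbr : ¬ Tendsto (dX X) (𝓝[upperHalf] (s : ℂ)) (𝓝 0)) :
    ∃ P : Fin 3 → ℂ → ℂ, (∀ k, AnalyticAt ℂ (P k) s) ∧
      (∀ᶠ z in 𝓝[upperHalf] (s : ℂ), ∀ k, weierstrassForm G H z k = P k z) ∧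
      (∃ k, P k s ≠ 0) ∧
      ∀ᶠ x : ℝ in 𝓝 s, ∃ ρ : ℝ, (ρ : ℂ) = u 0 * P 0 x + u 1 * P 1 x - u 2 * P 2 x ∧
        ∀ k, (starRingEnd ℂ) (P k x) = 2 * ρ * u k - P k x := by
  obtain ⟨F, hF, hFX⟩ := hGH.representation
  set W := weierstrassForm G H with hW
  have hFk : ∀ k, ∀ z ∈ upperHalf, HasDerivAt (fun z => F z k) (W z k) z :=
    fun k z hz => hasDerivAt_pi.1 (hF z hz) k
  have hXk : ∀ k, ContinuousOn (fun z => X z k) {x | 0 ≤ x.im} := fun k =>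
    (continuous_apply k).comp_continuousOn hXc
  -- components along covectors that vanish on the edge direction
  have hnormal : ∀ a : Fin 3 → ℝ, a 0 * u 0 + a 1 * u 1 + a 2 * u 2 = 0 →
      ∃ N : ℂ → ℂ, AnalyticAt ℂ N s ∧
        (∀ᶠ z in 𝓝[upperHalf] (s : ℂ), a 0 * W z 0 + a 1 * W z 1 + a 2 * W z 2 = N z) ∧
        ∀ᶠ x : ℝ in 𝓝 s, (N x).re = 0 := by
    intro a ha
    refine exists_analyticAt_deriv_of_re_eq_const
      (f := fun z => a 0 * F z 0 + a 1 * F z 1 + a 2 * F z 2)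
      (v := fun z => a 0 * X z 0 + a 1 * X z 1 + a 2 * X z 2)
      (c := a 0 * c 0 + a 1 * c 1 + a 2 * c 2) ?_ ?_ ?_ ?_
    · intro z hz
      exact (((hFk 0 z hz).const_mul _).add ((hFk 1 z hz).const_mul _)).add
        ((hFk 2 z hz).const_mul _)
    · have := hXk 0
      have := hXk 1
      have := hXk 2
      fun_prop
    · intro z hz
      simp [hFX z hz]
    · filter_upwards [hS] with x hx
      rw [hX x hx]
      simp only [Pi.add_apply, Pi.smul_apply, smul_eq_mul]
      linear_combination l x * ha
  obtain ⟨N0, hN0, hN0W, hN0r⟩ := hnormal ![0, -u 2, u 1] (by simp; ring)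
  obtain ⟨N1, hN1, hN1W, hN1r⟩ := hnormal ![u 2, 0, -u 0] (by simp; ring)
  obtain ⟨N2, hN2, hN2W, hN2r⟩ := hnormal ![u 1, -u 0, 0] (by simp; ring)
  simp only [Matrix.cons_val_zero, Matrix.cons_val_one, Matrix.cons_val, ofReal_zero, ofReal_neg]
    at hN0W hN1W hN2W
  have hE := lor_self_ofReal hu
  have hnull : ∀ z, W z 0 ^ 2 + W z 1 ^ 2 - W z 2 ^ 2 = 0 := fun z => by
    simp only [hW, weierstrassForm, Matrix.cons_val_zero, Matrix.cons_val_one, Matrix.cons_val]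
    linear_combination ((G z ^ 2 + H z ^ 2) ^ 2 - (2 * G z * H z) ^ 2) * I_sq
  -- the square of the component along the edge direction
  set q : ℂ → ℂ := fun z => N0 z ^ 2 + N1 z ^ 2 - N2 z ^ 2 with hq
  set φ : ℂ → ℂ := fun z => u 0 * W z 0 + u 1 * W z 1 - u 2 * W z 2 with hφ
  have hqa : AnalyticAt ℂ q s := by fun_prop
  have hφq : ∀ᶠ z in 𝓝[upperHalf] (s : ℂ), φ z ^ 2 = q z := by
    filter_upwards [hN0W, hN1W, hN2W] with z h0 h1 h2
    simp only [hq, hφ, ← h0, ← h1, ← h2]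
    linear_combination ((W z 0) ^ 2 + (W z 1) ^ 2 - (W z 2) ^ 2) * hE + hnull z
  have hh : ∀ z ∈ upperHalf, HasDerivAt (fun z => u 0 * F z 0 + u 1 * F z 1 - u 2 * F z 2)
      (φ z) z := fun z hz =>
    (((hFk 0 z hz).const_mul _).add ((hFk 1 z hz).const_mul _)).sub ((hFk 2 z hz).const_mul _)
  have hφd : DifferentiableOn ℂ φ upperHalf := by
    have h1 := hGH.holomorphic_left
    have h2 := hGH.holomorphic_right
    simp only [hφ, hW, weierstrassForm, Matrix.cons_val_zero, Matrix.cons_val_one,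
      Matrix.cons_val]
    fun_prop
  have hvc : ContinuousOn (fun z => lor u (X z)) {x | 0 ≤ x.im} := by
    have := hXk 0
    have := hXk 1
    have := hXk 2
    simp only [lor]
    fun_prop
  have him : ∀ᶠ x : ℝ in 𝓝 s, (q x).im = 0 := by
    filter_upwards [hN0r, hN1r, hN2r] with x h0 h1 h2
    simp [hq, pow_two, h0, h1, h2]
  have hnonneg : ∀ᶠ x : ℝ in 𝓝 s, 0 ≤ (q x).re := by
    filter_upwards [him.eventually_nhds, eventually_mem_nhds_iff.2 hS,
      continuous_ofReal.continuousAt.eventually hqa.eventually_analyticAt,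
      continuous_ofReal.continuousAt.eventually
        (eventually_eventually_nhds.2 (eventually_nhdsWithin_iff.1 hφq))] with x h1 h2 h3 h4
    by_contra! hneg
    obtain ⟨d, hd⟩ := eventually_const_of_sq_neg hh hφd hvc
      (fun z hz => by simp [lor, hFX z hz]) h3 (eventually_nhdsWithin_iff.2 h4) h1 hneg
    obtain ⟨y, ⟨hy1, hy2⟩, hxy⟩ :=
      (((hd.and h2).filter_mono nhdsWithin_le_nhds).and
        (self_mem_nhdsWithin : ∀ᶠ y in 𝓝[>] x, y ∈ Ioi x)).exists
    have hxy' := hl (mem_of_mem_nhds h2) hy2 hxy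
    have e1 := hd.self_of_nhds
    have hlX : ∀ y ∈ S, lor u (X y) = lor u c + l y := fun y hy => by
      rw [hX y hy]
      have : lor u (c + l y • u) = lor u c + l y * lor u u := by simp [lor]; ring
      rw [this, hu, mul_one]
    rw [hlX _ (mem_of_mem_nhds h2)] at e1
    rw [hlX _ hy2] at hy1
    linarith
  obtain ⟨r, hr, hrq⟩ := exists_analyticAt_sq_eq_of_nonneg hqa (him.and hnonneg)
  obtain ⟨σ, hσ, hσq, hσφ⟩ : ∃ σ : ℂ → ℂ, AnalyticAt ℂ σ s ∧
      (∀ᶠ z in 𝓝 (s : ℂ), σ z ^ 2 = q z) ∧ ∀ᶠ z in 𝓝[upperHalf] (s : ℂ), φ z = σ z := by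
    rcases eventually_eq_or_eq_neg_of_upperHalf hφd hr (by
      filter_upwards [hφq, nhdsWithin_le_nhds hrq] with z hz hz2
      rw [← hz2] at hz
      exact sq_eq_sq_iff_eq_or_eq_neg.1 hz) with h1 | h1
    · exact ⟨r, hr, hrq, h1⟩
    · exact ⟨-r, hr.neg, by simpa using hrq, h1⟩
  have hσre : ∀ᶠ x : ℝ in 𝓝 s, (σ x).im = 0 := by
    filter_upwards [continuous_ofReal.continuousAt.eventually hσq, him, hnonneg] with x h1 h2 h3
    rw [← h1] at h2 h3
    simp only [pow_two, mul_im, mul_re] at h2 h3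
    have h4 : (σ x).re * (σ x).im = 0 := by linarith
    rcases mul_eq_zero.1 h4 with h5 | h5
    · rw [h5] at h3; nlinarith
    · exact h5
  -- the three components of `σ u + u × N`
  set P : Fin 3 → ℂ → ℂ := ![fun z => σ z * u 0 + (u 1 * N2 z - u 2 * N1 z),
    fun z => σ z * u 1 + (u 2 * N0 z - u 0 * N2 z),
    fun z => σ z * u 2 - (u 0 * N1 z - u 1 * N0 z)] with hP
  have hPW : ∀ᶠ z in 𝓝[upperHalf] (s : ℂ), ∀ k, W z k = P k z := by
    filter_upwards [hN0W, hN1W, hN2W, hσφ] with z h0 h1 h2 h3 k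
    fin_cases k <;> simp [hP, ← h0, ← h1, ← h2, ← h3, hφ]
    · linear_combination (-W z 0) * hE
    · linear_combination (-W z 1) * hE
    · linear_combination (-W z 2) * hE
  have hPa : ∀ k, AnalyticAt ℂ (P k) s := by
    intro k
    fin_cases k <;> simp only [hP, Fin.zero_eta, Fin.mk_one, Fin.reduceFinMk,
      Matrix.cons_val_zero, Matrix.cons_val_one, Matrix.cons_val] <;> fun_prop
  refine ⟨P, hPa, hPW, ?_, ?_⟩
  · by_contra! h0
    refine hbr (tendsto_pi_nhds.2 fun k => ?_)
    have h1 : Tendsto (fun z => P k z / 2) (𝓝[upperHalf] (s : ℂ)) (𝓝 0) := by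
      have := ((hPa k).continuousAt.tendsto.div_const 2).mono_left
        (nhdsWithin_le_nhds (s := upperHalf))
      simpa [h0 k] using this
    refine h1.congr' ?_
    filter_upwards [hPW, self_mem_nhdsWithin] with z hz hzu
    rw [dX_eq_of_hasDerivAt hF hFX hzu, hz]
  · filter_upwards [hσre, hN0r, hN1r, hN2r] with x hx h0 h1 h2
    have c0 : (starRingEnd ℂ) (N0 x) = -N0 x := Complex.ext (by simp [h0]) (by simp)
    have c1 : (starRingEnd ℂ) (N1 x) = -N1 x := Complex.ext (by simp [h1]) (by simp)
    have c2 : (starRingEnd ℂ) (N2 x) = -N2 x := Complex.ext (by simp [h2]) (by simp)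
    have cσ : ((σ x).re : ℂ) = σ x := Complex.ext (by simp) (by simp [hx])
    refine ⟨(σ x).re, ?_, fun k => ?_⟩
    · rw [cσ]
      simp [hP]
      linear_combination (-σ x) * hE
    · have cσ' : (starRingEnd ℂ) (σ x) = σ x := conj_eq_iff_im.2 hx
      rw [cσ]
      fin_cases k <;> simp [hP, c0, c1, c2, cσ'] <;> ring

/-- Across every point of an edge, the Weierstrass data continue to their reflection by one of the
two pre-images of the half-turn about the edge. -/
theorem exists_extendsAcross {X : ℂ → L3} {G H : ℂ → ℂ} {u c : L3} {l : ℝ → ℝ}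
    {S : Set ℝ} {s : ℝ} (hu : lor u u = 1) (hXc : ContinuousOn X {x | 0 ≤ x.im})
    (hGH : IsWeierstrassData G H X) (hS : S ∈ 𝓝 s) (hl : StrictMonoOn l S)
    (hX : ∀ x ∈ S, X (x : ℂ) = c + l x • u)
    (hbr : ¬ Tendsto (dX X) (𝓝[upperHalf] (s : ℂ)) (𝓝 0)) :
    ∃ D, IsEdgeMat u D ∧ ExtendsAcross G H D s := by
  obtain ⟨P, hPa, hPW, ⟨k, hk⟩, hPr⟩ := exists_analyticAt_weierstrassForm hu hXc hGH hS hl hX hbr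
  set A : ℂ → ℂ := fun z => -(P 0 z + I * P 1 z) / 2 with hA
  set B : ℂ → ℂ := fun z => (P 0 z - I * P 1 z) / 2 with hB
  set C : ℂ → ℂ := fun z => -I * P 2 z / 2 with hC
  have hP0 := hPa 0
  have hP1 := hPa 1
  have hP2 := hPa 2
  have hAa : AnalyticAt ℂ A s := by fun_prop
  have hBa : AnalyticAt ℂ B s := by fun_prop
  have hCa : AnalyticAt ℂ C s := by fun_prop
  have hform : ∀ᶠ z in 𝓝[upperHalf] (s : ℂ),
      G z ^ 2 = A z ∧ H z ^ 2 = B z ∧ G z * H z = C z := by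
    filter_upwards [hPW] with z hz
    have h0 := hz 0
    have h1 := hz 1
    have h2 := hz 2
    simp only [weierstrassForm, Matrix.cons_val_zero, Matrix.cons_val_one, Matrix.cons_val]
      at h0 h1 h2
    simp only [hA, hB, hC, ← h0, ← h1, ← h2]
    refine ⟨?_, ?_, ?_⟩
    · linear_combination (1 / 2) * (G z ^ 2 + H z ^ 2) * I_sq
    · linear_combination (1 / 2) * (G z ^ 2 + H z ^ 2) * I_sq
    · linear_combination (G z * H z) * I_sq
  -- a common zero of `A` and `B` would be a zero of `C`, and so of all components of `P`
  have hAB : A s * B s = C s ^ 2 := by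
    refine (eventuallyEq_of_frequently_upperHalf (hAa.mul hBa) (hCa.pow 2)
      (Eventually.frequently ?_)).self_of_nhds
    filter_upwards [hform] with z hz
    simp only [Pi.mul_apply, Pi.pow_apply]
    rw [← hz.1, ← hz.2.1, ← hz.2.2]; ring
  have hne : A s ≠ 0 ∨ B s ≠ 0 := by
    by_contra! h0
    have hC0 : C s = 0 := by
      rw [h0.1, zero_mul] at hAB
      exact pow_eq_zero_iff (two_ne_zero) |>.1 hAB.symm
    have e2 : P 2 s = 0 := by simpa [hC] using hC0
    have e0 : P 0 s = 0 := by
      have h1 := h0.1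
      have h2 := h0.2
      simp only [hA, hB] at h1 h2
      linear_combination h2 - h1
    have e1 : P 1 s = 0 := by
      have h1 := h0.1
      simp only [hA, e0] at h1
      simpa using h1
    fin_cases k
    · exact hk e0
    · exact hk e1
    · exact hk e2
  obtain ⟨g, h, hg, hh, hGg, hHh⟩ : ∃ g h : ℂ → ℂ, AnalyticAt ℂ g s ∧ AnalyticAt ℂ h s ∧
      (∀ᶠ z in 𝓝[upperHalf] (s : ℂ), G z = g z) ∧
      ∀ᶠ z in 𝓝[upperHalf] (s : ℂ), H z = h z := by
    rcases hne with h0 | h0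
    · exact exists_analyticAt_pair hGH.holomorphic_left hAa hCa h0 (hform.mono fun z hz => hz.1)
        (hform.mono fun z hz => hz.2.2)
    · obtain ⟨h, g, hh, hg, hHh, hGg⟩ := exists_analyticAt_pair hGH.holomorphic_right hBa hCa h0
        (hform.mono fun z hz => hz.2.1) (hform.mono fun z hz => by rw [mul_comm]; exact hz.2.2)
      exact ⟨g, h, hg, hh, hGg, hHh⟩
  have hgA : (g ^ 2) =ᶠ[𝓝 (s : ℂ)] A := eventuallyEq_of_frequently_upperHalf (hg.pow 2) hAa
    (Eventually.frequently (by
      filter_upwards [hGg, hform] with z h1 h2; rw [Pi.pow_apply, ← h1, h2.1]))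
  have hhB : (h ^ 2) =ᶠ[𝓝 (s : ℂ)] B := eventuallyEq_of_frequently_upperHalf (hh.pow 2) hBa
    (Eventually.frequently (by
      filter_upwards [hHh, hform] with z h1 h2; rw [Pi.pow_apply, ← h1, h2.2.1]))
  have hghC : (g * h) =ᶠ[𝓝 (s : ℂ)] C := eventuallyEq_of_frequently_upperHalf (hg.mul hh) hCa
    (Eventually.frequently (by
      filter_upwards [hGg, hHh, hform] with z h1 h2 h3
      rw [Pi.mul_apply, ← h1, ← h2, h3.2.2]))
  have hrow : ∀ D, AnalyticAt ℂ (reflectedRow g h D) s := fun D => by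
    have h1 := analyticAt_conj_conj hg
    have h2 := analyticAt_conj_conj hh
    rw [analyticAt_pi_iff]
    intro j
    simp only [reflectedRow, Matrix.vecMul, dotProduct, Fin.sum_univ_two, Matrix.cons_val_zero,
      Matrix.cons_val_one]
    fun_prop
  have hga : AnalyticAt ℂ (fun z => ![g z, h z]) s := by
    rw [analyticAt_pi_iff]
    intro j
    fin_cases j
    · exact hg
    · exact hh
  have hreal : ∀ᶠ x : ℝ in 𝓝 s, ![g x, h x] = reflectedRow g h (edgeMat u) x ∨
      ![g x, h x] = -reflectedRow g h (edgeMat u) x := by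
    filter_upwards [continuous_ofReal.continuousAt.eventually (hgA.and (hhB.and hghC)), hPr]
      with x ⟨h1, h2, h3⟩ ⟨ρ, hρ, hp⟩
    have := eq_conj_vecMul_or_eq_neg hu (Or.inl rfl : IsEdgeMat u (edgeMat u)) (g := g x)
      (h := h x) (p := fun k => P k x) h1 h2 h3 hρ hp
    simpa only [reflectedRow, conj_ofReal] using this
  -- the sign is absorbed into the choice of the pre-image
  obtain ⟨D, hD, hDg⟩ : ∃ D, IsEdgeMat u D ∧
      (fun z => ![g z, h z]) =ᶠ[𝓝 (s : ℂ)] reflectedRow g h D := by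
    rcases eventually_eq_or_eq_neg_of_real hga (hrow (edgeMat u)) hreal with h1 | h1
    · exact ⟨edgeMat u, Or.inl rfl, h1⟩
    · refine ⟨-edgeMat u, Or.inr rfl, h1.trans (Eventually.of_forall fun z => ?_)⟩
      have e1 := IsEdgeMat.inv_eq hu (Or.inl rfl : IsEdgeMat u (edgeMat u))
      have e2 := IsEdgeMat.inv_eq hu (Or.inr rfl : IsEdgeMat u (-edgeMat u))
      simp only [Pi.neg_apply, reflectedRow, e1, e2, Matrix.mul_neg, Matrix.vecMul_neg, neg_neg]
  refine ⟨D, hD, fun z => ![g z, h z], hga, ?_⟩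
  have hc : Tendsto (starRingEnd ℂ) (𝓝 (s : ℂ)) (𝓝 (s : ℂ)) := by
    have := continuous_conj.tendsto (s : ℂ)
    rwa [conj_ofReal] at this
  have hup := eventually_nhdsWithin_iff.1 (hGg.and hHh)
  filter_upwards [hup, hc.eventually hup, hDg] with z h1 h2 h3
  refine ⟨fun hz => by rw [(h1 hz).1, (h1 hz).2], fun hz => ?_⟩
  have h4 := h2 (by simpa [upperHalf] using hz)
  rw [h3]
  simp only [reflectedRow, h4.1, h4.2]

theorem reflectedRow_neg {G H : ℂ → ℂ} {u : L3} {D : Matrix (Fin 2) (Fin 2) ℂ}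
    (hu : lor u u = 1) (hD : IsEdgeMat u D) (z : ℂ) :
    reflectedRow G H (-D) z = -reflectedRow G H D z := by
  have hD' : IsEdgeMat u (-D) := by
    rcases hD with rfl | rfl
    · exact Or.inr rfl
    · exact Or.inl (neg_neg _)
  simp only [reflectedRow, hD.inv_eq hu, hD'.inv_eq hu, Matrix.mul_neg, Matrix.vecMul_neg, neg_neg]

theorem reflectedRow_ne_zero {G H : ℂ → ℂ} {u : L3} {D : Matrix (Fin 2) (Fin 2) ℂ}
    (hu : lor u u = 1) (hD : IsEdgeMat u D) {z : ℂ}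
    (hz : ![G ((starRingEnd ℂ) z), H ((starRingEnd ℂ) z)] ≠ 0) : reflectedRow G H D z ≠ 0 := by
  intro h
  have h1 := congrArg (fun w => w ᵥ* (D * -matJ)) h
  simp only [reflectedRow, Matrix.zero_vecMul, Matrix.vecMul_vecMul] at h1
  have h2 : matJ * D⁻¹ * (D * -matJ) = 1 := by
    calc matJ * D⁻¹ * (D * -matJ) = matJ * (D⁻¹ * D) * -matJ := by simp only [Matrix.mul_assoc]
      _ = 1 := by rw [hD.inv_mul hu, mul_one, mul_neg, matJ_mul_self, neg_neg]
  rw [h2, Matrix.vecMul_one] at h1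
  refine hz (funext fun j => ?_)
  have h3 := congrFun h1 j
  fin_cases j <;> simpa using h3

theorem reflectedRow_eq_vecMul {G H : ℂ → ℂ} {u : L3} {D D' : Matrix (Fin 2) (Fin 2) ℂ}
    (hu : lor u u = 1) (hD : IsEdgeMat u D) (z : ℂ) :
    reflectedRow G H D' z = reflectedRow G H D z ᵥ* (D * D'⁻¹) := by
  rw [reflectedRow, reflectedRow, Matrix.vecMul_vecMul]
  congr 1
  calc matJ * D'⁻¹ = matJ * (D⁻¹ * D) * D'⁻¹ := by rw [hD.inv_mul hu, mul_one]
    _ = _ := by simp only [Matrix.mul_assoc]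

theorem ExtendsAcross.eventually {G H : ℂ → ℂ} {D : Matrix (Fin 2) (Fin 2) ℂ} {s : ℝ}
    (h : ExtendsAcross G H D s) : ∀ᶠ x : ℝ in 𝓝 s, ExtendsAcross G H D x := by
  obtain ⟨g, hg, hgr⟩ := h
  filter_upwards [continuous_ofReal.continuousAt.eventually
    (hg.eventually_analyticAt.and hgr.eventually_nhds)] with x hx
  exact ⟨g, hx.1, hx.2⟩

/-- The sign of the pre-image is determined by the behaviour near one point of the edge. -/
theorem ExtendsAcross.not_neg {G H : ℂ → ℂ} {u : L3} {D : Matrix (Fin 2) (Fin 2) ℂ} {s : ℝ}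
    (hu : lor u u = 1) (hD : IsEdgeMat u D) (hne : ∀ z ∈ upperHalf, ![G z, H z] ≠ 0)
    (h : ExtendsAcross G H D s) : ¬ ExtendsAcross G H (-D) s := by
  rintro ⟨g', hg', hgr'⟩
  obtain ⟨g, hg, hgr⟩ := h
  have heq : g =ᶠ[𝓝 (s : ℂ)] g' := by
    refine eventuallyEq_of_frequently_upperHalf hg hg' (Eventually.frequently ?_)
    filter_upwards [nhdsWithin_le_nhds hgr, nhdsWithin_le_nhds hgr', self_mem_nhdsWithin]
      with z h1 h2 h3
    rw [h1.1 h3, h2.1 h3]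
  have hc : Tendsto (starRingEnd ℂ) (𝓝[upperHalf] (s : ℂ)) (𝓝 (s : ℂ)) := by
    have := continuous_conj.tendsto (s : ℂ)
    rw [conj_ofReal] at this
    exact this.mono_left nhdsWithin_le_nhds
  obtain ⟨z, ⟨h1, h2, h3⟩, h4⟩ :=
    ((hc.eventually (heq.and (hgr.and hgr'))).and self_mem_nhdsWithin).exists
  have h4' : 0 < z.im := h4
  have h5 : ((starRingEnd ℂ) z).im < 0 := by simpa using h4'
  rw [h2.2 h5, h3.2 h5, reflectedRow_neg hu hD] at h1
  refine reflectedRow_ne_zero hu hD ?_ (self_eq_neg.1 h1)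
  rw [conj_conj]
  exact hne z h4

/-- One pre-image of the half-turn serves for the whole edge. -/
theorem exists_forall_extendsAcross {G H : ℂ → ℂ} {u : L3} {I : Set ℝ} (hu : lor u u = 1)
    (hne : ∀ z ∈ upperHalf, ![G z, H z] ≠ 0) (hI : IsPreconnected I)
    (h : ∀ s ∈ I, ∃ D, IsEdgeMat u D ∧ ExtendsAcross G H D s) :
    ∃ D, IsEdgeMat u D ∧ ∀ s ∈ I, ExtendsAcross G H D s := by
  set A := {s : ℝ | ExtendsAcross G H (edgeMat u) s} with hA
  set B := {s : ℝ | ExtendsAcross G H (-edgeMat u) s} with hB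
  have hAo : IsOpen A := isOpen_iff_mem_nhds.2 fun s hs => ExtendsAcross.eventually hs
  have hBo : IsOpen B := isOpen_iff_mem_nhds.2 fun s hs => ExtendsAcross.eventually hs
  have hdisj : Disjoint A B := Set.disjoint_left.2 fun s hs hs' =>
    ExtendsAcross.not_neg hu (Or.inl rfl) hne hs hs'
  have hcov : I ⊆ A ∪ B := fun s hs => by
    obtain ⟨D, rfl | rfl, hD⟩ := h s hs
    · exact Or.inl hD
    · exact Or.inr hD
  rcases isPreconnected_iff_subset_of_disjoint.1 hI A B hAo hBo hcov
    (by rw [hdisj.inter_eq, inter_empty]) with h1 | h1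
  · exact ⟨edgeMat u, Or.inl rfl, h1⟩
  · exact ⟨-edgeMat u, Or.inr rfl, h1⟩

/-! ### Analytic continuation along paths -/

/-- Uniqueness of analytic continuation along a path. -/
theorem ContinuesAlong.eventuallyEq {a b : ℂ} {γ : Path a b} {f g f' g' : ℂ → Fin 2 → ℂ}
    (h : ContinuesAlong γ f g) (h' : ContinuesAlong γ f' g') (hff : f =ᶠ[𝓝 a] f') :
    g =ᶠ[𝓝 b] g' := by
  obtain ⟨F, hFa, hFc, hF0, hF1⟩ := h
  obtain ⟨F', hFa', hFc', hF0', hF1'⟩ := h'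
  set A := {s : unitInterval | F s =ᶠ[𝓝 (γ s)] F' s} with hA
  have hAo : IsOpen A := by
    refine isOpen_iff_mem_nhds.2 fun s hs => ?_
    have h1 := γ.continuous.continuousAt.eventually (Filter.Eventually.eventually_nhds hs)
    filter_upwards [hFc s, hFc' s, h1] with s' e1 e2 e3
    exact e1.trans (EventuallyEq.trans e3 e2.symm)
  have hAc : IsClosed A := by
    refine isClosed_iff_frequently.2 fun s hs => ?_
    obtain ⟨r, hr, hball⟩ := Metric.eventually_nhds_iff_ball.1
      ((hFa s).eventually_analyticAt.and (hFa' s).eventually_analyticAt)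
    obtain ⟨s', e0, e1, e2, e3⟩ := (hs.and_eventually ((hFc s).and ((hFc' s).and
      (γ.continuous.continuousAt.eventually (ball_mem_nhds (γ s) hr))))).exists
    have e4 : F s =ᶠ[𝓝 (γ s')] F' s := e1.symm.trans (EventuallyEq.trans e0 e2)
    have e5 := AnalyticOnNhd.eqOn_of_preconnected_of_eventuallyEq
      (fun z hz => (hball z hz).1) (fun z hz => (hball z hz).2)
      (convex_ball (γ s) r).isPreconnected e3 e4
    exact e5.eventuallyEq_of_mem (ball_mem_nhds _ hr)
  have hA0 : (0 : unitInterval) ∈ A := by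
    have := hF0.trans (hff.trans hF0'.symm)
    simpa only [hA, mem_ofPred_eq, γ.source] using this
  have hA1 : (1 : unitInterval) ∈ A := by
    rw [IsClopen.eq_univ ⟨hAc, hAo⟩ ⟨0, hA0⟩]
    trivial
  have : F 1 =ᶠ[𝓝 b] F' 1 := by simpa only [hA, mem_ofPred_eq, γ.target] using hA1
  exact hF1.symm.trans (this.trans hF1')

theorem analyticAt_vecMul {f : ℂ → Fin 2 → ℂ} {z : ℂ} (hf : AnalyticAt ℂ f z)
    (M : Matrix (Fin 2) (Fin 2) ℂ) : AnalyticAt ℂ (fun x => f x ᵥ* M) z := by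
  rw [analyticAt_pi_iff] at hf ⊢
  intro j
  have h0 := hf 0
  have h1 := hf 1
  simp only [Matrix.vecMul, dotProduct, Fin.sum_univ_two]
  fun_prop

/-- The row vector `(G, H)` continues along a loop that leaves the upper half-plane across one edge
and comes back across another one. -/
theorem isMonodromyMatrix_mul_inv {G H : ℂ → ℂ} (hG : DifferentiableOn ℂ G upperHalf)
    (hH : DifferentiableOn ℂ H upperHalf) {u : L3} {D D' : Matrix (Fin 2) (Fin 2) ℂ}
    (hu : lor u u = 1) (hD : IsEdgeMat u D) {x₀ : ℂ} {γ : Path x₀ x₀} {s₁ s₂ : unitInterval}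
    (hs : s₁ < s₂) (hγ₁ : ∀ s, s < s₁ → 0 < (γ s).im) {r₁ : ℝ} (hr₁ : γ s₁ = r₁)
    (he₁ : ExtendsAcross G H D' r₁) (hγ₂ : ∀ s, s₁ < s → s < s₂ → (γ s).im < 0) {r₂ : ℝ}
    (hr₂ : γ s₂ = r₂) (he₂ : ExtendsAcross G H D r₂) (hγ₃ : ∀ s, s₂ < s → 0 < (γ s).im)
    (hx₀ : 0 < x₀.im) :
    IsMonodromyMatrix G H γ (D * D'⁻¹) := by
  obtain ⟨g₁, hg₁, hgr₁⟩ := he₁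
  obtain ⟨g₂, hg₂, hgr₂⟩ := he₂
  set M := D * D'⁻¹ with hM
  set row : ℂ → Fin 2 → ℂ := fun z => ![G z, H z] with hrow
  set low : ℂ → Fin 2 → ℂ := reflectedRow G H D' with hlow
  have hrowa : ∀ z : ℂ, 0 < z.im → AnalyticAt ℂ row z := fun z hz => by
    rw [hrow, analyticAt_pi_iff]
    intro j
    fin_cases j
    · exact hG.analyticAt (isOpen_upperHalf.mem_nhds hz)
    · exact hH.analyticAt (isOpen_upperHalf.mem_nhds hz)
  have hlowa : ∀ z : ℂ, z.im < 0 → AnalyticAt ℂ low z := fun z hz => by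
    have hconj : ∀ f : ℂ → ℂ, DifferentiableOn ℂ f upperHalf →
        AnalyticAt ℂ (fun z => (starRingEnd ℂ) (f ((starRingEnd ℂ) z))) z := fun f hf => by
      rw [analyticAt_iff_eventually_differentiableAt]
      filter_upwards [(isOpen_lt continuous_im continuous_const).mem_nhds
        (show z ∈ {z : ℂ | z.im < 0} from hz)] with w hw
      have hw' : w.im < 0 := hw
      exact differentiableAt_conj_conj_iff.2 (hf.differentiableAt
        (isOpen_upperHalf.mem_nhds (by simpa [upperHalf] using hw')))
    have h0 := hconj G hG
    have h1 := hconj H hH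
    refine analyticAt_vecMul (f := fun z => ![(starRingEnd ℂ) (G ((starRingEnd ℂ) z)),
      (starRingEnd ℂ) (H ((starRingEnd ℂ) z))]) ?_ _
    rw [analyticAt_pi_iff]
    intro j
    fin_cases j
    · exact h0
    · exact h1
  have hup : ∀ z : ℂ, 0 < z.im → ∀ᶠ y in 𝓝 z, 0 < y.im := fun z hz =>
    isOpen_upperHalf.mem_nhds hz
  have hdown : ∀ z : ℂ, z.im < 0 → ∀ᶠ y in 𝓝 z, y.im < 0 := fun z hz =>
    (isOpen_lt continuous_im continuous_const).mem_nhds hz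
  have h0 : 0 < s₁ := by
    rcases (unitInterval.nonneg' (t := s₁)).eq_or_lt with h | h
    · rw [← h, γ.source] at hr₁
      rw [hr₁] at hx₀
      simp at hx₀
    · exact h
  have h1 : s₂ < 1 := by
    rcases (unitInterval.le_one' (t := s₂)).eq_or_lt with h | h
    · rw [h, γ.target] at hr₂
      rw [hr₂] at hx₀
      simp at hx₀
    · exact h
  -- at the two crossings the germ is the local extension, which joins the functions on both sides
  set F : unitInterval → ℂ → Fin 2 → ℂ := fun s =>
    if s < s₁ then row else if s = s₁ then g₁ else if s < s₂ then low else
      if s = s₂ then fun z => g₂ z ᵥ* M else fun z => row z ᵥ* M with hF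
  have hFup : ∀ s, s < s₁ → F s = row := fun s h => by simp only [hF, if_pos h]
  have hF1 : F s₁ = g₁ := by simp only [hF, lt_irrefl, if_false, if_true]
  have hFlow : ∀ s, s₁ < s → s < s₂ → F s = low := fun s h h' => by
    simp only [hF, if_neg h.not_gt, if_neg h.ne', if_pos h']
  have hF2 : F s₂ = fun z => g₂ z ᵥ* M := by
    simp only [hF, if_neg hs.not_gt, if_neg hs.ne', lt_irrefl, if_false, if_true]
  have hFend : ∀ s, s₂ < s → F s = fun z => row z ᵥ* M := fun s h => by
    simp only [hF, if_neg (hs.trans h).not_gt, if_neg (hs.trans h).ne', if_neg h.not_gt,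
      if_neg h.ne']
  refine ⟨F, fun s => ?_, fun s => ?_, ?_, ?_⟩
  · rcases lt_trichotomy s s₁ with h | rfl | h
    · rw [hFup s h]; exact hrowa _ (hγ₁ s h)
    · rw [hF1, hr₁]; exact hg₁
    rcases lt_trichotomy s s₂ with h' | rfl | h'
    · rw [hFlow s h h']; exact hlowa _ (hγ₂ s h h')
    · rw [hF2, hr₂]; exact analyticAt_vecMul hg₂ _
    · rw [hFend s h']; exact analyticAt_vecMul (hrowa _ (hγ₃ s h')) _
  · rcases lt_trichotomy s s₁ with h | rfl | h
    · filter_upwards [isOpen_Iio.mem_nhds h] with s' h'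
      rw [hFup s h, hFup s' h']
    · have hev := γ.continuous.continuousAt.eventually (hr₁ ▸ hgr₁.eventually_nhds)
      filter_upwards [hev, isOpen_Iio.mem_nhds hs] with s' e1 e2
      rw [hF1]
      rcases lt_trichotomy s' s with h | rfl | h
      · rw [hFup s' h]
        filter_upwards [e1, hup _ (hγ₁ s' h)] with y e3 e4 using (e3.1 e4).symm
      · rw [hF1]
      · rw [hFlow s' h e2]
        filter_upwards [e1, hdown _ (hγ₂ s' h e2)] with y e3 e4 using (e3.2 e4).symm
    rcases lt_trichotomy s s₂ with h' | rfl | h'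
    · filter_upwards [isOpen_Ioo.mem_nhds ⟨h, h'⟩] with s' e
      rw [hFlow s h h', hFlow s' e.1 e.2]
    · have hev := γ.continuous.continuousAt.eventually (hr₂ ▸ hgr₂.eventually_nhds)
      filter_upwards [hev, isOpen_Ioi.mem_nhds hs] with s' e1 e2
      rw [hF2]
      rcases lt_trichotomy s' s with h | rfl | h
      · rw [hFlow s' e2 h]
        filter_upwards [e1, hdown _ (hγ₂ s' e2 h)] with y e3 e4
        rw [hlow, e3.2 e4, hM, ← reflectedRow_eq_vecMul hu hD]
      · rw [hF2]
      · rw [hFend s' h]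
        filter_upwards [e1, hup _ (hγ₃ s' h)] with y e3 e4
        rw [e3.1 e4]
    · filter_upwards [isOpen_Ioi.mem_nhds h'] with s' e
      rw [hFend s h', hFend s' e]
  · rw [hFup 0 h0]
  · rw [hFend 1 h1]

/-! ### Linear independence of the Weierstrass data -/

theorem isOpen_edgeInterval {n : ℕ} (t : Fin (n + 2) → ℝ) (i : Fin (n + 3)) :
    IsOpen (edgeInterval t i) := by
  unfold edgeInterval
  split_ifs
  exacts [isOpen_Ioo, isOpen_Ioi, isOpen_Iio]

theorem isPreconnected_edgeInterval {n : ℕ} (t : Fin (n + 2) → ℝ) (i : Fin (n + 3)) :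
    IsPreconnected (edgeInterval t i) := by
  unfold edgeInterval
  split_ifs
  exacts [isPreconnected_Ioo, isPreconnected_Ioi, isPreconnected_Iio]

theorem nonempty_edgeInterval {n : ℕ} {t : Fin (n + 2) → ℝ} (ht : StrictMono t)
    (i : Fin (n + 3)) : (edgeInterval t i).Nonempty := by
  unfold edgeInterval
  split_ifs
  · exact nonempty_Ioo.2 (ht (by simp))
  · exact nonempty_Ioi
  · exact nonempty_Iio

/-- Linearly dependent Weierstrass data would put the surface, hence its boundary, into a plane. -/
theorem linearIndependent_weierstrassData {n : ℕ} {u : Fin (n + 3) → L3} {t : Fin (n + 2) → ℝ}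
    {X : ℂ → L3} {G H : ℂ → ℂ} (hu : IsSpacelikeNonplanar u) (hX : IsPolygonalMaxface u t X)
    (hGH : IsWeierstrassData G H X) {x₀ : ℂ} (hx₀ : 0 < x₀.im) {a b : ℂ}
    (hab : ∀ᶠ z in 𝓝 x₀, a * G z + b * H z = 0) : a = 0 ∧ b = 0 := by
  by_contra hne
  have hz : ∀ z ∈ upperHalf, a * G z + b * H z = 0 := by
    have h1 : AnalyticOnNhd ℂ (fun z => a * G z + b * H z) upperHalf :=
      DifferentiableOn.analyticOnNhd
        ((hGH.holomorphic_left.const_mul a).add (hGH.holomorphic_right.const_mul b))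
        isOpen_upperHalf
    exact h1.eqOn_zero_of_preconnected_of_eventuallyEq_zero convex_upperHalf.isPreconnected
      hx₀ hab
  obtain ⟨k, m, hkm⟩ : ∃ (k : ℂ → ℂ) (m : Fin 3 → ℂ), ∀ z ∈ upperHalf, ∀ j,
      weierstrassForm G H z j = k z * m j := by
    rcases eq_or_ne b 0 with rfl | hb
    · have ha : a ≠ 0 := fun h => hne ⟨h, rfl⟩
      refine ⟨fun z => H z ^ 2, ![1, I, 0], fun z hzu j => ?_⟩
      have h0 : G z = 0 := by
        have := hz z hzu
        rw [zero_mul, add_zero] at this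
        exact (mul_eq_zero.1 this).resolve_left ha
      fin_cases j <;> simp [weierstrassForm, h0, mul_comm]
    · refine ⟨fun z => G z ^ 2, ![(a / b) ^ 2 - 1, I * (1 + (a / b) ^ 2), -2 * I * (a / b)],
        fun z hzu j => ?_⟩
      have h0 : H z = -(a / b) * G z := by
        have := hz z hzu
        field_simp
        linear_combination this
      fin_cases j <;> simp [weierstrassForm, h0] <;> ring
  -- the real and imaginary parts of `m` span at most a plane, which a real covector annihilates
  obtain ⟨c, hc, hc0⟩ : ∃ c : Fin 3 → ℝ, Fintype.linearCombination ℝ m c = 0 ∧ c ≠ 0 := by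
    have : LinearMap.ker (Fintype.linearCombination ℝ m) ≠ ⊥ :=
      LinearMap.ker_ne_bot_of_finrank_lt (by simp [Complex.finrank_real_complex])
    obtain ⟨c, hc, hc0⟩ := Submodule.exists_mem_ne_zero_of_ne_bot this
    exact ⟨c, hc, hc0⟩
  have hcm : (c 0 : ℂ) * m 0 + c 1 * m 1 + c 2 * m 2 = 0 := by
    simpa [Fintype.linearCombination_apply, Fin.sum_univ_three] using hc
  obtain ⟨F, hF, hFX⟩ := hGH.representation
  have hder : ∀ z ∈ upperHalf,
      HasDerivAt (fun z => c 0 * F z 0 + c 1 * F z 1 + c 2 * F z 2) 0 z := fun z hzu => by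
    have h1 := fun j => hasDerivAt_pi.1 (hF z hzu) j
    have h2 := (((h1 0).const_mul (c 0 : ℂ)).add ((h1 1).const_mul (c 1 : ℂ))).add
      ((h1 2).const_mul (c 2 : ℂ))
    refine h2.congr_deriv ?_
    rw [hkm z hzu, hkm z hzu, hkm z hzu]
    linear_combination k z * hcm
  obtain ⟨d, hd⟩ := isOpen_upperHalf.exists_is_const_of_deriv_eq_zero
    convex_upperHalf.isPreconnected
    (fun z hzu => (hder z hzu).differentiableAt.differentiableWithinAt)
    (fun z hzu => (hder z hzu).deriv)
  have hplane : ∀ x : ℝ, c 0 * X x 0 + c 1 * X x 1 + c 2 * X x 2 = d.re := by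
    have hcont : ContinuousOn (fun z => c 0 * X z 0 + c 1 * X z 1 + c 2 * X z 2)
        {x | 0 ≤ x.im} := by
      have h1 : ∀ k, ContinuousOn (fun z => X z k) {x | 0 ≤ x.im} := fun k =>
        (continuous_apply k).comp_continuousOn hX.continuousOn
      have := h1 0
      have := h1 1
      have := h1 2
      fun_prop
    have heq : EqOn (fun z => c 0 * X z 0 + c 1 * X z 1 + c 2 * X z 2) (fun _ => d.re)
        {x | 0 ≤ x.im} := by
      refine EqOn.of_subset_closure (s := upperHalf) (fun z hzu => ?_) hcont continuousOn_const
        (fun z hzu => le_of_lt (show 0 < z.im from hzu)) ?_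
      · have := congrArg Complex.re (hd z hzu)
        simpa [hFX z hzu] using this
      · rw [upperHalf, closure_setOfPred_lt_im]
    exact fun x => heq (show 0 ≤ (x : ℂ).im by simp)
  have hcu : ∀ i, Fintype.linearCombination ℝ c (u i) = 0 := fun i => by
    obtain ⟨p, l, hl, hpl⟩ := hX.edge i
    obtain ⟨x, hx⟩ := nonempty_edgeInterval hX.strictMono i
    obtain ⟨y, hy, hxy⟩ := (((isOpen_edgeInterval t i).mem_nhds hx |> fun h =>
      (Filter.Eventually.filter_mono nhdsWithin_le_nhds h :
        ∀ᶠ y in 𝓝[>] x, y ∈ edgeInterval t i)).and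
      (self_mem_nhdsWithin : ∀ᶠ y in 𝓝[>] x, y ∈ Ioi x)).exists
    have hlt := hl hx hy hxy
    have h1 := hplane x
    have h2 := hplane y
    rw [hpl x hx] at h1
    rw [hpl y hy] at h2
    simp only [Pi.add_apply, Pi.smul_apply, smul_eq_mul] at h1 h2
    rw [Fintype.linearCombination_apply, Fin.sum_univ_three]
    simp only [smul_eq_mul]
    refine (mul_eq_zero.1 (?_ : (l y - l x) * _ = 0)).resolve_left (sub_pos.2 hlt).ne'
    linear_combination h2 - h1
  have hzero : Fintype.linearCombination ℝ c = 0 :=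
    LinearMap.ext_on_range hu.nonplanar fun i => by rw [hcu i, LinearMap.zero_apply]
  refine hc0 (funext fun j => ?_)
  have := LinearMap.congr_fun hzero (Pi.single j 1)
  simpa [Fintype.linearCombination_apply_single] using this

end Minkowski
end

theorem mainTheorem4 (n : ℕ) (u : Fin (n + 3) → Minkowski.L3) (t : Fin (n + 2) → ℝ)
    (X : ℂ → Minkowski.L3) (G H : ℂ → ℂ)
    (hu : Minkowski.IsSpacelikeNonplanar u)
    (hX : Minkowski.IsPolygonalMaxface u t X)
    (hGH : Minkowski.IsWeierstrassData G H X) :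
    ∃ M D : Fin (n + 3) → Matrix (Fin 2) (Fin 2) ℂ,
      -- `M i` is the monodromy matrix of `(G, H)` around the pre-image of vertex `i`
      (∀ i, ∀ x₀ : ℂ, 0 < x₀.im → ∀ γ : Path x₀ x₀, Minkowski.IsVertexLoop t i γ →
        ∀ N, Minkowski.IsMonodromyMatrix G H γ N ↔ N = M i) ∧
      -- `D i` is a pre-image in `SU⁻(1,1)` of the half-turn about the direction of edge `i`
      (∀ i, D i ∈ Minkowski.SU11minus ∧
        Minkowski.IsSpinImageMinus (D i) (Minkowski.halfTurn (u i))) ∧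
      (∀ i, M i = D i * (D (i - 1))⁻¹) ∧
      -- `M i` lies in `SU(1,1)` over the rotation with axis `v i` and angle `2 π θ i`
      (∀ i, M i ∈ Minkowski.SU11 ∧
        ∃ R : Matrix (Fin 3) (Fin 3) ℝ,
          Minkowski.IsSpinImage (M i) (fun v => R *ᵥ v) ∧
          Minkowski.IsTimelikeRotation R (Minkowski.vertexNormal u i)
            (2 * Real.pi * Minkowski.exteriorAngle u i)) := by
  open Minkowski in
  have hne : ∀ z ∈ upperHalf, ![G z, H z] ≠ 0 := fun z hz h0 => by
    obtain ⟨F, hF, hFX⟩ := hGH.representation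
    have hG : G z = 0 := by simpa using congrFun h0 0
    have hH : H z = 0 := by simpa using congrFun h0 1
    refine hX.maxface.no_branch z hz (funext fun k => ?_)
    rw [dX_eq_of_hasDerivAt hF hFX hz]
    fin_cases k <;> simp [weierstrassForm, hG, hH]
  have hedge : ∀ i, ∃ D, IsEdgeMat (u i) D ∧ ∀ s ∈ edgeInterval t i, ExtendsAcross G H D s := by
    intro i
    obtain ⟨c, l, hl, hcl⟩ := hX.edge i
    exact exists_forall_extendsAcross (hu.unit i) hne (isPreconnected_edgeInterval t i)
      fun s hs => exists_extendsAcross (hu.unit i) hX.continuousOn hGH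
        ((isOpen_edgeInterval t i).mem_nhds hs) hl hcl (hX.no_boundary_branch i s hs)
  choose D hD hDe using hedge
  refine ⟨fun i => D i * (D (i - 1))⁻¹, D, ?_, fun i => ⟨(hD i).mem_SU11minus (hu.unit i),
    (hD i).isSpinImageMinus (hu.unit i)⟩, fun i => rfl, fun i => ⟨mul_inv_mem_SU11 (hu.unit i)
    (hu.unit _) (hD i) (hD _), _, isSpinImage_mul_inv (hu.unit i) (hu.unit _) (hD i) (hD _),
    isTimelikeRotation_halfTurnMat_mul (hu.unit i) (hu.unit _) (hu.timelike_normal i)⟩⟩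
  rintro i x₀ hx₀ γ ⟨s₁, s₂, hs, h1, ⟨r₁, hr₁, hγ₁⟩, h2, ⟨r₂, hr₂, hγ₂⟩, h3⟩ N
  have hmon := isMonodromyMatrix_mul_inv hGH.holomorphic_left hGH.holomorphic_right (hu.unit i)
    (hD i) hs h1 hγ₁ (hDe _ r₁ hr₁) h2 hγ₂ (hDe _ r₂ hr₂) h3 hx₀
  refine ⟨fun hN => ?_, fun hN => hN ▸ hmon⟩
  have heq := ContinuesAlong.eventuallyEq hN hmon Filter.EventuallyEq.rfl
  set M := D i * (D (i - 1))⁻¹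
  have hcol : ∀ j, N 0 j - M 0 j = 0 ∧ N 1 j - M 1 j = 0 := fun j => by
    refine linearIndependent_weierstrassData hu hX hGH hx₀ ?_
    filter_upwards [heq] with z hz
    have := congrFun hz j
    simp only [Matrix.vecMul, dotProduct, Fin.sum_univ_two, Matrix.cons_val_zero,
      Matrix.cons_val_one] at this
    linear_combination this
  ext k j
  fin_cases k
  · exact sub_eq_zero.1 (hcol j).1
  · exact sub_eq_zero.1 (hcol j).2
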